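/- Let $T>0$ and let $B$ be a standard Brownian motion on $[0,T]$ on a probability space $(\Omega,\mathcal F,P)$; let $(\mathcal F_t)_{0\le t\le T}$ be the filtration generated by $B$ and the $P$-null sets, and write $L^2=L^2(\Omega,\mathcal F,P)$. *Economy.* Let $f:\mathbb R\to(1,4)$ be smooth with $f'>0$ on $(-\infty,0)$, $f'<0$ on $(0,\infty)$, $f(0)>3$, $\lim_{c\to\pm\infty}f(c)=1$ and $\int f(B(T))\,dP<2$. Consider the two-consumer exchange economy with consumption set $\mathbb R_+\times L^2_+$ (consumption at dates $0$ and $T$), endowments $(1,e^1)=(1,f(B(T)))$ and $(3,e^2)=(3,4-f(B(T)))$, and the common utility $U(x_0,x)=u(x_0)+\int u(x)\,dP$, where $u:\mathbb R\to\mathbb R$ is smooth, strictly increasing and strictly concave. A Walrasian equilibrium is a price $(p_0,p)\in\mathbb R_{++}\times L^2_{++}$ and consumptions that satisfy the budget constraints, are optimal (every strictly preferred bundle costs strictly more) and clear the markets. *Assets.* $A_0=1$ and $A_1=g(B(T))$, where $g:\mathbb R\to\mathbb R$ is smooth, strictly increasing and convex, $g\to0$ at $-\infty$, $g\to+\infty$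 at $+\infty$, and $g$ is square-integrable under the centered Gaussian law with variance $T$ (so $A_1\in L^2$). The risk-neutral measure is $Q=P$, so the price of $A_j$ at time $t$ is $E[A_j\mid\mathcal F_t]$. *Strategies.* An almost simple strategy is a process $\theta=(\theta_0,\theta_1)$ on $[0,T]$ for which there is a finite or infinite sequence of times $0=t_0<t_1<\dots<T$, converging to $T$ if infinite, such that on each $(t_i,t_{i+1}]$ (on $(t_N,T]$ if $t_N$ is the last time) $\theta$ is constant in time with $\mathcal F_{t_i}$-measurable components in $L^2$; $\theta(0)$ is $\mathcal F_0$-measurable and $\theta(T)$ is $\mathcal F_T$-measurable. Put $\operatorname{div}\theta(t)=\theta_0(t)A_0+\theta_1(t)A_1$. The strategy is self-financing if $E[\operatorname{div}\theta(s)\mid\mathcal F_s]=E[\operatorname{div}\theta(t)\mid\mathcal F_s]$ for all $0\le s\le t\le T$, or if its market value at each time is its initial value plus the accumulated gains from trade (the gains up to $T$ being an $L^1$ limit of the gains up to the trading times). It respects consumer 1's terminal wealth constraint if $\operatorname{div}\theta(T)+e^1\ge0$, and it supports the net trade $z'\in L^2$ if $\operatorname{div}\theta(T)=z'$. **Claim.**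 There is a constant $a<2$ such that: 1. the economy has a Walrasian equilibrium, and in every Walrasian equilibrium the consumptions are $(a,a)$ for consumer 1 and $(4-a,4-a)$ for consumer 2; so consumer 1's Walrasian net trade at date $T$ is $z=a-f(B(T))$; 2. there are $\varepsilon>0$ and $t^*\in(0,T)$ for which there do **not** exist a time $t^{**}\in(0,t^*)$, a finite $\mathcal F_{t^{**}}$-measurable partition $(X_\ell)$ of $\Omega$ and real coefficients $\alpha_{j\ell}$ ($j=0,1$) such that $\Psi=\sum_{j,\ell}\alpha_{j\ell}\mathbf 1_{X_\ell}A_j$ satisfies both (a) $E[\Psi+e^1\mid\mathcal F_{t^*}]\ge0$ and (b) $\big\|E[\Psi-z\mid\mathcal F_{t^*}]\big\|_{L^2}<\varepsilon$; 3. there is no sequence or net of self-financing almost simple strategies that respect consumer 1's terminal wealth constraint and support net trades converging weakly in $L^2$ to $z$. (Equalities and inequalities between random variables are $P$-almost sure.) -/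

import Mathlib

open MeasureTheory ProbabilityTheory Filter Topology
open scoped NNReal ENNReal

noncomputable section

/-! ## Brownian motion on `[0, T]` and its augmented filtration -/

/-- `B` restricted to `[0, T]` is a standard Brownian motion (the values `B t`, `t > T`, play
no role). -/
structure IsBrownianOn {Ω : Type*} [MeasurableSpace Ω] (P : Measure Ω) (T : ℝ≥0)
    (B : ℝ≥0 → Ω → ℝ) : Prop where
  measurable : ∀ t ≤ T, Measurable (B t)
  zero : ∀ᵐ ω ∂P, B 0 ω = 0
  gaussian : ∀ s t, s ≤ t → t ≤ T → P.map (fun ω => B t ω - B s ω) = gaussianReal 0 (t - s)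
  indep : ∀ s t, s ≤ t → t ≤ T →
    Indep (⨆ r ≤ s, MeasurableSpace.comap (B r) inferInstance)
      (MeasurableSpace.comap (fun ω => B t ω - B s ω) inferInstance) P
  continuousOn : ∀ᵐ ω ∂P, ContinuousOn (fun t => B t ω) (Set.Iic T)

/-- The filtration `(𝓕 t)`, `0 ≤ t ≤ T`, generated by `B` and the null sets of `P` (it is constant
after time `T`). -/
def brownianFiltration {Ω : Type*} [mΩ : MeasurableSpace Ω] (P : Measure Ω) (T : ℝ≥0)
    (B : ℝ≥0 → Ω → ℝ) (hB : ∀ t ≤ T, Measurable (B t)) : Filtration ℝ≥0 mΩ where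
  seq t := (⨆ r ≤ min t T, MeasurableSpace.comap (B r) inferInstance) ⊔
    MeasurableSpace.generateFrom {N | MeasurableSet N ∧ P N = 0}
  mono' _ _ hst :=
    sup_le_sup_right (biSup_mono fun _ hr => hr.trans (min_le_min_right T hst)) _
  le' _ := sup_le
    (iSup₂_le fun r hr => (hB r (hr.trans (min_le_right _ _))).comap_le)
    (MeasurableSpace.generateFrom_le fun _ hN => hN.1)

/-! ## The static exchange economy -/

/-- Consumption bundles: certain consumption at date `0`, random consumption at date `T`. -/
abbrev Bundle (Ω : Type*) : Type _ := ℝ × (Ω → ℝ)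

/-- Membership in the consumption set `ℝ₊ × L²₊`. -/
def IsConsumption {Ω : Type*} [MeasurableSpace Ω] (P : Measure Ω) (x : Bundle Ω) : Prop :=
  0 ≤ x.1 ∧ MemLp x.2 2 P ∧ ∀ᵐ ω ∂P, 0 ≤ x.2 ω

/-- The value `p₀ x₀ + ∫ p x dP` of the bundle `x` at the price `p`. -/
def bundleCost {Ω : Type*} [MeasurableSpace Ω] (P : Measure Ω) (p x : Bundle Ω) : ℝ :=
  p.1 * x.1 + ∫ ω, p.2 ω * x.2 ω ∂P

/-- Expected utility with felicity function `u`. -/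
def expectedUtility {Ω : Type*} [MeasurableSpace Ω] (P : Measure Ω) (u : ℝ → ℝ)
    (x : Bundle Ω) : ℝ :=
  u x.1 + ∫ ω, u (x.2 ω) ∂P

/-- Walrasian (Arrow-Debreu) equilibrium of the exchange economy with utility functions `U i` and
endowments `e i`. -/
structure IsWalrasianEquilibrium {Ω I : Type*} [MeasurableSpace Ω] [Fintype I] (P : Measure Ω)
    (U : I → Bundle Ω → ℝ) (e : I → Bundle Ω) (p : Bundle Ω) (x : I → Bundle Ω) : Prop where
  price_zero_pos : 0 < p.1
  price_memLp : MemLp p.2 2 P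
  price_pos : ∀ᵐ ω ∂P, 0 < p.2 ω
  consumption : ∀ i, IsConsumption P (x i)
  budget : ∀ i, bundleCost P p (x i) ≤ bundleCost P p (e i)
  optimal : ∀ i y, IsConsumption P y → U i (x i) < U i y →
    bundleCost P p (x i) < bundleCost P p y
  clearing_zero : ∑ i, (x i).1 = ∑ i, (e i).1
  clearing_terminal : ∀ᵐ ω ∂P, ∑ i, (x i).2 ω = ∑ i, (e i).2 ω

/-! ## Assets, prices and trading strategies -/

section Trading

variable {Ω ι : Type*} [mΩ : MeasurableSpace Ω] [Fintype ι]

/-- A trading strategy: `θ t ω j` is the holding of asset `j` at time `t` in state `ω`. -/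
abbrev Strategy (Ω ι : Type*) : Type _ := ℝ≥0 → Ω → ι → ℝ

/-- The dividend `div θ(t)`, paid at the terminal date, of the portfolio held at time `t`. -/
def dividend (A : ι → Ω → ℝ) (θ : Strategy Ω ι) (t : ℝ≥0) (ω : Ω) : ℝ :=
  ∑ j, θ t ω j * A j ω

/-- The price at time `t` of asset `j`: its expected dividend under the risk-neutral measure `Q`,
conditional on the information available at time `t`. -/
def assetPrice (Q : Measure Ω) (𝓕 : Filtration ℝ≥0 mΩ) (A : ι → Ω → ℝ) (j : ι) (t : ℝ≥0) :
    Ω → ℝ :=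
  Q[A j | 𝓕 t]

/-- The market value at time `t` of the portfolio held at time `t`. -/
def marketValue (Q : Measure Ω) (𝓕 : Filtration ℝ≥0 mΩ) (A : ι → Ω → ℝ) (θ : Strategy Ω ι)
    (t : ℝ≥0) (ω : Ω) : ℝ :=
  ∑ j, θ t ω j * assetPrice Q 𝓕 A j t ω

/-- `θ` is an almost simple strategy with trading times `0 = τ 0 < τ 1 < ... < T`: it is constant in
time, equal to an `𝓕 (τ i)`-measurable square-integrable portfolio, on each `(τ i, τ (i + 1)]`,
and trades only finitely often before any time `t < T`. A strategy with finitely many trading times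
`τ 0 < ... < τ N < T` is the case `τ i = T` for `i > N`. -/
structure IsAlmostSimple (P : Measure Ω) (𝓕 : Filtration ℝ≥0 mΩ) (T : ℝ≥0) (τ : ℕ → ℝ≥0)
    (θ : Strategy Ω ι) : Prop where
  time_zero : τ 0 = 0
  time_le : ∀ i, τ i ≤ T
  time_mono : Monotone τ
  time_lt : ∀ i, τ i < T → τ i < τ (i + 1)
  time_tendsto : Tendsto τ atTop (𝓝 T)
  initial : ∀ j, StronglyMeasurable[𝓕 0] (fun ω => θ 0 ω j)
  piecewise : ∃ h : ℕ → Ω → ι → ℝ,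
    (∀ i, τ i < T → ∀ j, StronglyMeasurable[𝓕 (τ i)] (fun ω => h i ω j) ∧
      MemLp (fun ω => h i ω j) 2 P) ∧
    ∀ i, ∀ t, τ i < t → t ≤ τ (i + 1) → θ t = h i
  terminal : ∀ j, StronglyMeasurable[𝓕 T] (fun ω => θ T ω j)

/-- Self-financing, in the form it takes under risk-neutral pricing:
`E_Q(div θ(s) | 𝓕 s) = E_Q(div θ(t) | 𝓕 s)` for `0 ≤ s ≤ t ≤ T`. -/
def IsSelfFinancing (Q : Measure Ω) (𝓕 : Filtration ℝ≥0 mΩ) (T : ℝ≥0) (A : ι → Ω → ℝ)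
    (θ : Strategy Ω ι) : Prop :=
  ∀ s t, s ≤ t → t ≤ T → Q[dividend A θ s | 𝓕 s] =ᵐ[Q] Q[dividend A θ t | 𝓕 s]

/-- Self-financing through gains: the market value is the initial value plus the accumulated gains
from trade. For `t < T` the gains are the elementary stochastic integral of the piecewise constant
strategy; the gains up to `T` are their limit in mean. -/
def IsSelfFinancingGains (Q : Measure Ω) (𝓕 : Filtration ℝ≥0 mΩ) (T : ℝ≥0) (A : ι → Ω → ℝ)
    (τ : ℕ → ℝ≥0) (θ : Strategy Ω ι) : Prop :=
  (∀ n, ∀ t ≤ τ n, marketValue Q 𝓕 A θ t =ᵐ[Q] fun ω => marketValue Q 𝓕 A θ 0 ω +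
    ∑ i ∈ Finset.range n, ∑ j, θ (τ (i + 1)) ω j *
      (assetPrice Q 𝓕 A j (min (τ (i + 1)) t) ω - assetPrice Q 𝓕 A j (min (τ i) t) ω)) ∧
  Tendsto (fun n => eLpNorm (fun ω => marketValue Q 𝓕 A θ (τ n) ω - marketValue Q 𝓕 A θ T ω) 1 Q)
    atTop (𝓝 0)

/-- The terminal wealth constraint `div θ(T) + e ≥ 0`. -/
def RespectsTerminalWealth (P : Measure Ω) (T : ℝ≥0) (A : ι → Ω → ℝ) (e : Ω → ℝ)
    (θ : Strategy Ω ι) : Prop :=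
  ∀ᵐ ω ∂P, 0 ≤ dividend A θ T ω + e ω

/-- `θ` supports the net trade `z ∈ L²`, i.e. `div θ(T) = z`. -/
def SupportsNetTrade (P : Measure Ω) (T : ℝ≥0) (A : ι → Ω → ℝ) (θ : Strategy Ω ι) (z : Ω → ℝ) :
    Prop :=
  MemLp z 2 P ∧ dividend A θ T =ᵐ[P] z

/-- Weak convergence in `L²(P)` of `z k` to `z` along the filter `l`. -/
def TendstoWeakly {κ : Type*} (P : Measure Ω) (l : Filter κ) (z : κ → Ω → ℝ) (z' : Ω → ℝ) : Prop :=
  ∀ φ : Ω → ℝ, MemLp φ 2 P → Tendsto (fun k => ∫ ω, (z k ω - z' ω) * φ ω ∂P) l (𝓝 0)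

/-- The payoff `∑ α j l 1_{X l} A j` of holding the portfolio `α · l` on the event `X l`. -/
def partitionPayoff (A : ι → Ω → ℝ) {N : ℕ} (X : Fin N → Set Ω) (α : ι → Fin N → ℝ) (ω : Ω) : ℝ :=
  ∑ j, ∑ l, α j l * (X l).indicator (fun _ => (1 : ℝ)) ω * A j ω

/-- The necessary condition for approximability, at the time `t` (called `t*` in prose) and the
accuracy `ε`: there are a time `s ∈ (0, t)` (called `t**`), a finite `𝓕 s`-measurable partition
`X` and coefficients `α` whose payoff `Ψ` satisfies `E_Q[Ψ + e | 𝓕 t] ≥ 0` and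
`‖E_Q[Ψ - z | 𝓕 t]‖ < ε` in `L²(P)`. -/
def PartitionCondition (P Q : Measure Ω) (𝓕 : Filtration ℝ≥0 mΩ) (A : ι → Ω → ℝ)
    (e z : Ω → ℝ) (t : ℝ≥0) (ε : ℝ) : Prop :=
  ∃ s : ℝ≥0, 0 < s ∧ s < t ∧ ∃ (N : ℕ) (X : Fin N → Set Ω) (α : ι → Fin N → ℝ),
    (∀ l, MeasurableSet[𝓕 s] (X l)) ∧ Pairwise (Function.onFun Disjoint X) ∧
    (⋃ l, X l) = Set.univ ∧
    (∀ᵐ ω ∂P, 0 ≤ (Q[fun ω' => partitionPayoff A X α ω' + e ω' | 𝓕 t]) ω) ∧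
    eLpNorm (Q[fun ω' => partitionPayoff A X α ω' - z ω' | 𝓕 t]) 2 P < ENNReal.ofReal ε

end Trading

/-! ## The two-consumer, two-asset economy of the example -/

/-- Endowments `(1, f(B(T)))` and `(3, 4 - f(B(T)))`; `W` stands for `B(T)`. -/
def exampleEndowment {Ω : Type*} (f : ℝ → ℝ) (W : Ω → ℝ) : Fin 2 → Bundle Ω :=
  ![(1, fun ω => f (W ω)), (3, fun ω => 4 - f (W ω))]

/-- Assets `A₀ = 1` and `A₁ = g(B(T))`; `W` stands for `B(T)`. -/
def exampleAsset {Ω : Type*} (g : ℝ → ℝ) (W : Ω → ℝ) : Fin 2 → Ω → ℝ :=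
  ![fun _ => 1, fun ω => g (W ω)]

end

/-! Equilibrium. Total resources are constant, so strict concavity forces constant consumptions.
Otherwise both consumers would strictly prefer the constant bundles with the same total mean, and
each of these would have to cost strictly more than the bundle it replaces, although together they
cost the same. Optimality of a positive constant bundle is a first-order condition that makes the
price constant (`price_eq_const_of_optimal_const`). The budget then gives `2 * a = 1 + E f(B(T))`,
hence `a < 2`.

Non-approximability. Fix a portfolio `(h₀, h₁)` at time `s` and require its conditional expected
wealth to be nonnegative at a later time `t < T`. Between `s` and `t` the path can fall so far that
the stock is nearly worthless and the endowment nearly `1`, hence `h₀ ≥ -1`. It can also rise so far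
that any short position in the stock is ruinous, hence `h₁ ≥ 0`. Wealth is therefore at least
`f(B(T)) - 1` (`sub_measure_le_setIntegral`). For `t` close to `T`, the event `C` that `B t` is near
`0` makes `f(B(T))` average more than `1 + a` on `C`, because `1 + a < 3 < f 0`
(`exists_lt_setIntegral`). So integrated wealth on `C` exceeds that of the equilibrium consumption
`a` by a fixed `ε > 0`.

Integration over `C` is continuous for the norm of the conditional expectation and also for weak
convergence, so the same gap refutes both kinds of approximation. Strategies reduce to fixed
portfolios because a self-financing almost simple strategy holds at `t` a portfolio chosen strictly
before `t`, whose dividend has the same conditional expectation as the terminal net trade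
(`exists_portfolio`). -/

/-! ## The exchange economy -/

/-- A strictly increasing, strictly concave, differentiable function lies strictly below its
tangents, whose slopes are positive. -/
lemma exists_pos_strict_supporting_slope {w : ℝ → ℝ} (hw : Differentiable ℝ w)
    (hw_mono : StrictMono w) (hw_concave : StrictConcaveOn ℝ Set.univ w) (a : ℝ) :
    ∃ c > 0, HasDerivAt w c a ∧ ∀ y, y ≠ a → w y < w a + c * (y - a) := by
  have hd := (hw a).hasDerivAt
  have key : ∀ y, y ≠ a → w y < w a + deriv w a * (y - a) := by
    intro y hy
    rcases lt_or_gt_of_ne hy with h | h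
    · have := hw_concave.lt_slope_of_hasDerivAt (Set.mem_univ y) (Set.mem_univ a) h hd
      rw [slope_def_field, lt_div_iff₀ (by linarith)] at this
      linarith
    · have := hw_concave.slope_lt_of_hasDerivAt (Set.mem_univ a) (Set.mem_univ y) h hd
      rw [slope_def_field, div_lt_iff₀ (by linarith)] at this
      linarith
  refine ⟨deriv w a, ?_, hd, key⟩
  have h1 := key (a + 1) (by simp)
  have h2 := hw_mono (show a < a + 1 by simp)
  linarith [show deriv w a * (a + 1 - a) = deriv w a by ring]

lemma bundleCost_one {Ω : Type*} [MeasurableSpace Ω] {P : Measure Ω} (x : Bundle Ω) :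
    bundleCost P (1, fun _ => 1) x = x.1 + ∫ ω, x.2 ω ∂P := by
  simp [bundleCost]

lemma bundleCost_const {Ω : Type*} [MeasurableSpace Ω] {P : Measure Ω} (p : Bundle Ω) (a : ℝ) :
    bundleCost P p (a, fun _ => a) = (p.1 + ∫ ω, p.2 ω ∂P) * a := by
  simp [bundleCost, integral_mul_const]; ring

section Economy

variable {Ω : Type*} [mΩ : MeasurableSpace Ω] {P : Measure Ω} [IsProbabilityMeasure P]
  {w : ℝ → ℝ}

/-- On nonnegative consumption, `w` lies between the constant `w 0` and its tangent at `0`, so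
utility grows at most linearly. -/
lemma IsConsumption.integrable_comp (hw : Differentiable ℝ w) (hw_mono : StrictMono w)
    (hw_concave : StrictConcaveOn ℝ Set.univ w) {x : Bundle Ω} (hx : IsConsumption P x) :
    Integrable (fun ω => w (x.2 ω)) P := by
  obtain ⟨c, hc, -, h⟩ := exists_pos_strict_supporting_slope hw hw_mono hw_concave 0
  have hi : Integrable x.2 P := hx.2.1.integrable (by norm_num)
  refine Integrable.mono' ((hi.norm.const_mul c).add (integrable_const |w 0|))
    (hw.continuous.comp_aestronglyMeasurable hi.1) ?_
  filter_upwards [hx.2.2] with ω hω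
  have h1 := hw_mono.monotone hω
  have h2 : w (x.2 ω) ≤ w 0 + c * x.2 ω := by
    rcases eq_or_ne (x.2 ω) 0 with h0 | h0
    · simp [h0]
    · simpa using (h _ h0).le
  simp only [Pi.add_apply, Real.norm_eq_abs, abs_of_nonneg hω]
  have := mul_nonneg hc.le hω
  rw [abs_le]
  constructor <;> cases abs_cases (w 0) <;> linarith

/-- Expected utility lies below its tangent at a constant bundle. -/
lemma expectedUtility_lt_of_ne_const (hw : Differentiable ℝ w) (hw_mono : StrictMono w)
    (hw_concave : StrictConcaveOn ℝ Set.univ w) (a : ℝ) : ∃ c > 0, HasDerivAt w c a ∧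
    ∀ x : Bundle Ω, IsConsumption P x →
      expectedUtility P w x ≤ 2 * w a + c * (x.1 + ∫ ω, x.2 ω ∂P - 2 * a) ∧
      (¬ (x.1 = a ∧ ∀ᵐ ω ∂P, x.2 ω = a) →
        expectedUtility P w x < 2 * w a + c * (x.1 + ∫ ω, x.2 ω ∂P - 2 * a)) := by
  obtain ⟨c, hc, hd, h⟩ := exists_pos_strict_supporting_slope hw hw_mono hw_concave a
  have hle : ∀ y, w y ≤ w a + c * (y - a) := fun y => by
    rcases eq_or_ne y a with rfl | hy
    · simp
    · exact (h y hy).le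
  refine ⟨c, hc, hd, fun x hx => ?_⟩
  have hi : Integrable x.2 P := hx.2.1.integrable (by norm_num)
  have hwi := hx.integrable_comp hw hw_mono hw_concave
  have hci : Integrable (fun ω => c * (x.2 ω - a)) P :=
    (hi.sub (integrable_const a)).const_mul c
  have hti : Integrable (fun ω => w a + c * (x.2 ω - a)) P :=
    (integrable_const _).add hci
  have hint : ∫ ω, (w a + c * (x.2 ω - a)) ∂P = w a + c * (∫ ω, x.2 ω ∂P - a) := by
    rw [integral_add (integrable_const _) hci,
      integral_const_mul, integral_sub hi (integrable_const a)]
    simp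
  have h2 : ∫ ω, w (x.2 ω) ∂P ≤ w a + c * (∫ ω, x.2 ω ∂P - a) := by
    rw [← hint]
    exact integral_mono hwi hti fun ω => hle _
  have h1 := hle x.1
  refine ⟨by unfold expectedUtility; linarith, fun hne => ?_⟩
  by_contra hcon
  unfold expectedUtility at hcon
  have e1 : x.1 = a := by
    by_contra h0
    have := h _ h0
    linarith
  -- The gap between tangent and utility is nonnegative. Once its integral is zero it vanishes
  -- almost surely, and strictness of the tangent inequality gives `x.2 = a`.
  have e2 : ∫ ω, (w a + c * (x.2 ω - a) - w (x.2 ω)) ∂P = 0 := by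
    rw [integral_sub hti hwi, hint]
    linarith
  rw [integral_eq_zero_iff_of_nonneg (fun ω => sub_nonneg.2 (hle _)) (hti.sub hwi)] at e2
  refine hne ⟨e1, ?_⟩
  filter_upwards [e2] with ω hω
  by_contra h0
  have := h _ h0
  simp only [Pi.zero_apply] at hω
  linarith

lemma isConsumption_const {a : ℝ} (ha : 0 ≤ a) : IsConsumption P (a, fun _ => a) :=
  ⟨ha, memLp_const a, ae_of_all _ fun _ => ha⟩

lemma expectedUtility_const (a : ℝ) :
    expectedUtility P w (a, fun _ => a) = 2 * w a := by
  simp [expectedUtility]; ring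

variable {f : ℝ → ℝ} {W : Ω → ℝ}

lemma memLp_comp_endowment (hf : Continuous f) (hf_range : ∀ c, 1 < f c ∧ f c < 4)
    (hW : Measurable W) : MemLp (fun ω => f (W ω)) 2 P :=
  MemLp.of_bound (hf.measurable.comp hW).aestronglyMeasurable 4 <| ae_of_all _ fun ω => by
    rw [Real.norm_eq_abs, abs_le]
    constructor <;> linarith [hf_range (W ω)]

lemma one_le_integral_endowment (hf : Continuous f) (hf_range : ∀ c, 1 < f c ∧ f c < 4)
    (hW : Measurable W) : 1 ≤ ∫ ω, f (W ω) ∂P := by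
  have := integral_mono (μ := P) (integrable_const (1 : ℝ))
    ((memLp_comp_endowment (P := P) hf hf_range hW).integrable (by norm_num))
    (fun ω => (hf_range (W ω)).1.le)
  simpa using this

/-- Constant prices and constant consumptions form a Walrasian equilibrium. -/
lemma isWalrasianEquilibrium_const (hw : Differentiable ℝ w) (hw_mono : StrictMono w)
    (hw_concave : StrictConcaveOn ℝ Set.univ w) (hf : Continuous f)
    (hf_range : ∀ c, 1 < f c ∧ f c < 4) (hW : Measurable W) (hf_mean : ∫ ω, f (W ω) ∂P < 2)
    {a : ℝ} (ha : 2 * a = 1 + ∫ ω, f (W ω) ∂P) :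
    IsWalrasianEquilibrium P (fun _ => expectedUtility P w) (exampleEndowment f W)
      (1, fun _ => 1) ![(a, fun _ => a), (4 - a, fun _ => 4 - a)] := by
  have h1 := one_le_integral_endowment (P := P) hf hf_range hW
  have hi : Integrable (fun ω => f (W ω)) P :=
    (memLp_comp_endowment hf hf_range hW).integrable (by norm_num)
  -- At unit prices the cost of a bundle is its total mean, which is the quantity multiplying `c` in
  -- the tangent inequality.
  have hcons : ∀ b : ℝ, ∀ y : Bundle Ω, IsConsumption P y →
      expectedUtility P w (b, fun _ => b) < expectedUtility P w y →
      bundleCost P (1, fun _ => 1) (b, fun _ => b) < bundleCost P (1, fun _ => 1) y := by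
    intro b y hy hlt
    obtain ⟨c, hc, -, h⟩ := expectedUtility_lt_of_ne_const (P := P) hw hw_mono hw_concave b
    have h2 := (h y hy).1
    rw [expectedUtility_const] at hlt
    rw [bundleCost_const, bundleCost_one]
    have h3 : 0 < c * (y.1 + ∫ ω, y.2 ω ∂P - 2 * b) := by linarith
    have h4 := (mul_pos_iff_of_pos_left hc).1 h3
    simp only [integral_const, probReal_univ, smul_eq_mul]
    linarith
  refine ⟨one_pos, memLp_const _, ae_of_all _ fun _ => one_pos, ?_, ?_, ?_, ?_, ?_⟩
  · intro i
    fin_cases i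
    · exact isConsumption_const (by linarith)
    · exact isConsumption_const (by linarith)
  · intro i
    fin_cases i
    · simp only [exampleEndowment, Fin.zero_eta, Matrix.cons_val_zero, bundleCost_const,
        bundleCost_one, integral_const, probReal_univ, smul_eq_mul]
      linarith
    · simp only [exampleEndowment, Fin.mk_one, Matrix.cons_val_one, Matrix.cons_val_fin_one,
        bundleCost_const, bundleCost_one, integral_const, probReal_univ, smul_eq_mul]
      rw [integral_sub (integrable_const _) hi]
      simp
      linarith
  · intro i
    fin_cases i
    · exact hcons a
    · exact hcons (4 - a)
  · simp [exampleEndowment]; norm_num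
  · exact ae_of_all _ fun ω => by simp [exampleEndowment]

/-- If a positive constant bundle is optimal at the price `p`, then `p` is constant. -/
lemma price_eq_const_of_optimal_const (hw : Differentiable ℝ w) (hw_mono : StrictMono w)
    (hw_concave : StrictConcaveOn ℝ Set.univ w) {p : Bundle Ω} (hp0 : 0 < p.1)
    (hp : Integrable p.2 P) {m : ℝ} (hm : 0 < m)
    (hopt : ∀ y, IsConsumption P y → 2 * w m < expectedUtility P w y →
      (p.1 + ∫ ω, p.2 ω ∂P) * m < bundleCost P p y) :
    ∀ᵐ ω ∂P, p.2 ω = p.1 := by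
  obtain ⟨c, hc, hd, -⟩ := exists_pos_strict_supporting_slope hw hw_mono hw_concave m
  suffices h : p.2 =ᵐ[P] fun _ => p.1 from h
  refine ae_eq_of_forall_setIntegral_eq_of_sigmaFinite (fun s _ _ => hp.integrableOn)
    (fun s _ _ => (integrable_const _).integrableOn) fun s hs _ => ?_
  -- One extra unit on the event `s` is paid for by giving up `q` units at date `0`. Then `φ r` is
  -- the utility of a zero-cost perturbation of size `r`.
  set q : ℝ := (∫ ω in s, p.2 ω ∂P) / p.1 with hq
  set φ : ℝ → ℝ := fun r => w (m - r * q) + (P.real s * w (m + r) + (1 - P.real s) * w m) with hφ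
  have hφd : HasDerivAt φ (c * (P.real s - q)) 0 := by
    have d1 : HasDerivAt (fun r : ℝ => m - r * q) (-q) 0 := by
      simpa using ((hasDerivAt_id (0 : ℝ)).mul_const q).const_sub m
    have d2 : HasDerivAt (fun r : ℝ => m + r) 1 0 := (hasDerivAt_id (0 : ℝ)).const_add m
    have e1 : HasDerivAt w c (m - 0 * q) := by simpa using hd
    have e2 : HasDerivAt w c (m + 0) := by simpa using hd
    have := (e1.comp (0 : ℝ) d1).add
      (((e2.comp (0 : ℝ) d2).const_mul (P.real s)).add_const ((1 - P.real s) * w m))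
    exact this.congr_deriv (by ring)
  -- Since `m > 0`, small perturbations of either sign are feasible. They cost nothing, so by
  -- optimality none is preferred.
  have hmax : IsLocalMax φ 0 := by
    have n1 : ∀ᶠ r : ℝ in 𝓝 0, 0 < m - r * q :=
      (by fun_prop : Continuous fun r : ℝ => m - r * q).continuousAt.eventually_const_lt
        (by simpa using hm)
    have n2 : ∀ᶠ r : ℝ in 𝓝 0, 0 < m + r :=
      (by fun_prop : Continuous fun r : ℝ => m + r).continuousAt.eventually_const_lt
        (by simpa using hm)
    filter_upwards [n1, n2] with r h1 h2
    by_contra! hcon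
    have hφ0 : φ 0 = 2 * w m := by simp [hφ]; ring
    have hy : IsConsumption P (m - r * q, fun ω => m + s.indicator (fun _ => r) ω) := by
      refine ⟨h1.le, (memLp_const m).add ((memLp_const r).indicator hs), ae_of_all _ fun ω => ?_⟩
      by_cases h : ω ∈ s
      · simpa [h] using h2.le
      · simpa [h] using hm.le
    have hU : expectedUtility P w (m - r * q, fun ω => m + s.indicator (fun _ => r) ω) = φ r := by
      have : ∀ ω, w (m + s.indicator (fun _ => r) ω)
          = s.indicator (fun _ => w (m + r) - w m) ω + w m := by
        intro ω
        by_cases h : ω ∈ s <;> simp [h]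
      simp only [expectedUtility, this, hφ]
      rw [integral_add ((integrable_const _).indicator hs) (integrable_const _),
        integral_indicator_const _ hs]
      simp
      ring
    have hlt := hopt _ hy (by rw [hU, ← hφ0]; exact hcon)
    have hcost : bundleCost P p (m - r * q, fun ω => m + s.indicator (fun _ => r) ω)
        = (p.1 + ∫ ω, p.2 ω ∂P) * m := by
      have : ∀ ω, p.2 ω * (m + s.indicator (fun _ => r) ω)
          = p.2 ω * m + s.indicator (fun ω => p.2 ω * r) ω := by
        intro ω
        by_cases h : ω ∈ s <;> simp [h]; ring
      simp only [bundleCost, this]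
      rw [integral_add (hp.mul_const m) ((hp.mul_const r).indicator hs), integral_indicator hs,
        integral_mul_const, integral_mul_const, hq]
      field_simp
      ring
    linarith
  have h0 := hmax.hasDerivAt_eq_zero hφd
  have h1 : P.real s = q := by
    rcases mul_eq_zero.1 h0 with h | h
    · exact absurd h hc.ne'
    · linarith
  rw [setIntegral_const, smul_eq_mul, h1, hq]
  field_simp

/-- Every Walrasian equilibrium has the same constant consumptions. -/
lemma IsWalrasianEquilibrium.consumption_eq (hw : Differentiable ℝ w) (hw_mono : StrictMono w)
    (hw_concave : StrictConcaveOn ℝ Set.univ w) (hf : Continuous f)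
    (hf_range : ∀ c, 1 < f c ∧ f c < 4) (hW : Measurable W)
    {a : ℝ} (ha : 2 * a = 1 + ∫ ω, f (W ω) ∂P) {p : Bundle Ω} {x : Fin 2 → Bundle Ω}
    (hx : IsWalrasianEquilibrium P (fun _ => expectedUtility P w) (exampleEndowment f W) p x) :
    ((x 0).1 = a ∧ ∀ᵐ ω ∂P, (x 0).2 ω = a) ∧
      ((x 1).1 = 4 - a ∧ ∀ᵐ ω ∂P, (x 1).2 ω = 4 - a) := by
  have hFi : MemLp (fun ω => f (W ω)) 2 P := memLp_comp_endowment hf hf_range hW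
  have hpi : Integrable p.2 P := hx.price_memLp.integrable (by norm_num)
  have hx0i : Integrable (x 0).2 P := (hx.consumption 0).2.1.integrable (by norm_num)
  have hx1i : Integrable (x 1).2 P := (hx.consumption 1).2.1.integrable (by norm_num)
  have hpF : Integrable (fun ω => p.2 ω * f (W ω)) P := hx.price_memLp.integrable_mul hFi
  have hpx0 : Integrable (fun ω => p.2 ω * (x 0).2 ω) P :=
    hx.price_memLp.integrable_mul (hx.consumption 0).2.1
  have hpx1 : Integrable (fun ω => p.2 ω * (x 1).2 ω) P :=
    hx.price_memLp.integrable_mul (hx.consumption 1).2.1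
  have cz : (x 0).1 + (x 1).1 = 4 := by
    have := hx.clearing_zero
    simp only [exampleEndowment, Fin.sum_univ_two, Matrix.cons_val_zero, Matrix.cons_val_one,
      Matrix.cons_val_fin_one] at this
    linarith
  have ct : ∀ᵐ ω ∂P, (x 1).2 ω = 4 - (x 0).2 ω := by
    filter_upwards [hx.clearing_terminal] with ω hω
    simp only [exampleEndowment, Fin.sum_univ_two, Matrix.cons_val_zero, Matrix.cons_val_one,
      Matrix.cons_val_fin_one] at hω
    linarith
  have hsum : bundleCost P p (x 0) + bundleCost P p (x 1) = (p.1 + ∫ ω, p.2 ω ∂P) * 4 := by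
    have : ∫ ω, p.2 ω * (x 0).2 ω ∂P + ∫ ω, p.2 ω * (x 1).2 ω ∂P = (∫ ω, p.2 ω ∂P) * 4 := by
      rw [← integral_add hpx0 hpx1, ← integral_mul_const]
      refine integral_congr_ae ?_
      filter_upwards [ct] with ω hω
      rw [hω]; ring
    simp only [bundleCost]
    linear_combination this + p.1 * cz
  have hE1 : ∫ ω, (x 1).2 ω ∂P = 4 - ∫ ω, (x 0).2 ω ∂P := by
    rw [integral_congr_ae ct, integral_sub (integrable_const _) hx0i]
    simp
  set m : ℝ := ((x 0).1 + ∫ ω, (x 0).2 ω ∂P) / 2 with hm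
  have hm0 : 0 ≤ m := div_nonneg (add_nonneg (hx.consumption 0).1
    (integral_nonneg_of_ae (hx.consumption 0).2.2)) zero_le_two
  have hm1 : 0 ≤ 4 - m := by
    have := add_nonneg (hx.consumption 1).1 (integral_nonneg_of_ae (hx.consumption 1).2.2)
    rw [hE1] at this
    linarith
  -- By market clearing, if one consumption is not the constant bundle then neither is the other.
  -- Both constants are then strictly preferred, and adding the two strict cost inequalities
  -- contradicts `hsum`.
  have hxm : (x 0).1 = m ∧ ∀ᵐ ω ∂P, (x 0).2 ω = m := by
    by_contra hne
    have hne1 : ¬ ((x 1).1 = 4 - m ∧ ∀ᵐ ω ∂P, (x 1).2 ω = 4 - m) := by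
      rintro ⟨h1, h2⟩
      refine hne ⟨by linarith, ?_⟩
      filter_upwards [h2, ct] with ω h3 h4
      linarith
    obtain ⟨c, -, -, h⟩ := expectedUtility_lt_of_ne_const (P := P) hw hw_mono hw_concave m
    obtain ⟨c', -, -, h'⟩ :=
      expectedUtility_lt_of_ne_const (P := P) hw hw_mono hw_concave (4 - m)
    have l0 := (h _ (hx.consumption 0)).2 hne
    have l1 := (h' _ (hx.consumption 1)).2 hne1
    rw [show (x 0).1 + ∫ ω, (x 0).2 ω ∂P - 2 * m = 0 by rw [hm]; ring, mul_zero, add_zero,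
      ← expectedUtility_const (P := P)] at l0
    rw [show (x 1).1 + ∫ ω, (x 1).2 ω ∂P - 2 * (4 - m) = 0 by rw [hE1, hm]; linarith, mul_zero,
      add_zero, ← expectedUtility_const (P := P)] at l1
    have k0 := hx.optimal 0 _ (isConsumption_const hm0) l0
    have k1 := hx.optimal 1 _ (isConsumption_const hm1) l1
    rw [bundleCost_const] at k0 k1
    linarith
  have hcost0 : bundleCost P p (x 0) = (p.1 + ∫ ω, p.2 ω ∂P) * m := by
    have : ∫ ω, p.2 ω * (x 0).2 ω ∂P = (∫ ω, p.2 ω ∂P) * m := by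
      rw [← integral_mul_const]
      refine integral_congr_ae ?_
      filter_upwards [hxm.2] with ω hω
      rw [hω]
    rw [bundleCost, hxm.1, this]; ring
  have hU0 : expectedUtility P w (x 0) = 2 * w m := by
    have : ∫ ω, w ((x 0).2 ω) ∂P = ∫ _, w m ∂P := integral_congr_ae (by
      filter_upwards [hxm.2] with ω hω
      rw [hω])
    rw [expectedUtility, hxm.1, this]
    simp; ring
  have b0 := hx.budget 0
  have b1 := hx.budget 1
  have he0 : bundleCost P p (exampleEndowment f W 0) = p.1 + ∫ ω, p.2 ω * f (W ω) ∂P := by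
    simp [bundleCost, exampleEndowment]
  have he1 : bundleCost P p (exampleEndowment f W 1)
      = p.1 * 3 + ((∫ ω, p.2 ω ∂P) * 4 - ∫ ω, p.2 ω * f (W ω) ∂P) := by
    rw [← integral_mul_const, ← integral_sub (hpi.mul_const 4) hpF]
    simp [bundleCost, exampleEndowment, mul_sub]
  -- Consumptions and endowments have the same total cost, so both budget constraints bind.
  have hbud : (p.1 + ∫ ω, p.2 ω ∂P) * m = p.1 + ∫ ω, p.2 ω * f (W ω) ∂P := by
    rw [← hcost0, ← he0]
    refine le_antisymm b0 ?_
    rw [he1] at b1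
    rw [he0]
    linarith
  have hpF0 : 0 ≤ ∫ ω, p.2 ω * f (W ω) ∂P := integral_nonneg_of_ae (by
    filter_upwards [hx.price_pos] with ω hω
    exact mul_nonneg hω.le (by linarith [hf_range (W ω)]))
  have hmpos : 0 < m := by
    refine hm0.lt_of_ne fun h0 => ?_
    rw [← h0, mul_zero] at hbud
    linarith [hx.price_zero_pos]
  have hpc := price_eq_const_of_optimal_const hw hw_mono hw_concave hx.price_zero_pos hpi hmpos
    (fun y hy hlt => by
      rw [← hcost0]
      exact hx.optimal 0 y hy (by rw [hU0]; exact hlt))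
  have hma : m = a := by
    have i1 : ∫ ω, p.2 ω ∂P = p.1 := by
      rw [integral_congr_ae hpc]; simp
    have i2 : ∫ ω, p.2 ω * f (W ω) ∂P = p.1 * ∫ ω, f (W ω) ∂P := by
      rw [← integral_const_mul]
      refine integral_congr_ae ?_
      filter_upwards [hpc] with ω hω
      rw [hω]
    rw [i1, i2] at hbud
    have : p.1 * (2 * m) = p.1 * (2 * a) := by rw [ha]; linarith
    have := mul_left_cancel₀ hx.price_zero_pos.ne' this
    linarith
  rw [hma] at hxm
  refine ⟨hxm, by linarith [hxm.1], ?_⟩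
  filter_upwards [ct, hxm.2] with ω h1 h2
  rw [h1, h2]

end Economy

/-! ## Independence of Brownian increments from the augmented filtration -/

/-- Adding null sets to a σ-algebra preserves independence. -/
lemma Indep.sup_generateFrom_null {Ω : Type*} {m₁ m₂ mΩ : MeasurableSpace Ω} {P : Measure Ω}
    (h : Indep m₁ m₂ P) :
    Indep (m₁ ⊔ MeasurableSpace.generateFrom {N | MeasurableSet N ∧ P N = 0}) m₂ P := by
  rw [Indep_iff] at h ⊢
  intro A C hA hC
  -- Every event of the enlarged σ-algebra agrees almost surely with an event of `m₁`.
  have hle : m₁ ⊔ MeasurableSpace.generateFrom {N | MeasurableSet N ∧ P N = 0} ≤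
      eventuallyMeasurableSpace m₁ (ae P) := by
    refine sup_le le_eventuallyMeasurableSpace (MeasurableSpace.generateFrom_le fun N hN => ?_)
    exact ⟨∅, @MeasurableSet.empty _ m₁, ae_eq_empty.2 hN.2⟩
  obtain ⟨A', hA', hAA'⟩ := hle A hA
  rw [measure_congr (hAA'.inter (ae_eq_refl C)), measure_congr hAA', h A' C hA' hC]

section Brownian

variable {Ω : Type*} [mΩ : MeasurableSpace Ω] {P : Measure Ω} {T : ℝ≥0} {B : ℝ≥0 → Ω → ℝ}

namespace IsBrownianOn

/-- The augmented filtration of a Brownian motion. -/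
abbrev filtration (hB : IsBrownianOn P T B) : Filtration ℝ≥0 mΩ :=
  brownianFiltration P T B hB.measurable

variable (hB : IsBrownianOn P T B)
include hB

lemma measurable_filtration {s t : ℝ≥0} (hst : s ≤ t) (ht : t ≤ T) :
    Measurable[hB.filtration t] (B s) := by
  have h : MeasurableSpace.comap (B s) inferInstance ≤ hB.filtration t :=
    le_sup_of_le_left (le_iSup₂_of_le (f := fun r (_ : r ≤ min t T) =>
      MeasurableSpace.comap (B r) inferInstance) s (le_min hst (hst.trans ht)) le_rfl)
  exact measurable_iff_comap_le.2 h

lemma indep_filtration {s t : ℝ≥0} (hst : s ≤ t) (ht : t ≤ T) :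
    Indep (hB.filtration s)
      (MeasurableSpace.comap (fun ω => B t ω - B s ω) inferInstance) P := by
  have h := Indep.sup_generateFrom_null (hB.indep s t hst ht)
  have e : min s T = s := min_eq_left (hst.trans ht)
  change Indep ((⨆ r ≤ min s T, MeasurableSpace.comap (B r) inferInstance) ⊔ _) _ P
  rw [e]
  exact h

lemma measurable_sub {s t : ℝ≥0} (hst : s ≤ t) (ht : t ≤ T) :
    Measurable fun ω => B t ω - B s ω :=
  (hB.measurable t ht).sub (hB.measurable s (hst.trans ht))

/-- Nondegenerate increments charge every nonempty open set. -/
lemma measure_increment_pos {s t : ℝ≥0} (hst : s < t) (ht : t ≤ T) {U : Set ℝ} (hU : IsOpen U)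
    (hne : U.Nonempty) : 0 < P {ω | B t ω - B s ω ∈ U} := by
  have h1 : P {ω | B t ω - B s ω ∈ U} = gaussianReal 0 (t - s) U := by
    rw [← hB.gaussian s t hst.le ht,
      Measure.map_apply (hB.measurable_sub hst.le ht) hU.measurableSet]
    rfl
  rw [h1, pos_iff_ne_zero]
  intro h0
  exact (hU.measure_pos volume hne).ne'
    (gaussianReal_absolutelyContinuous' 0 (tsub_pos_of_lt hst).ne' h0)

lemma measure_pos {t : ℝ≥0} (h0 : 0 < t) (ht : t ≤ T) {U : Set ℝ} (hU : IsOpen U)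
    (hne : U.Nonempty) : 0 < P {ω | B t ω ∈ U} := by
  have h := hB.measure_increment_pos h0 ht hU hne
  rwa [measure_congr (show {ω | B t ω - B 0 ω ∈ U} =ᵐ[P] {ω | B t ω ∈ U} from ?_)] at h
  filter_upwards [hB.zero] with ω hω
  simp only [eq_iff_iff]
  change B t ω - B 0 ω ∈ U ↔ B t ω ∈ U
  rw [hω, sub_zero]

lemma measure_inter_increment {s t : ℝ≥0} (hst : s ≤ t) (ht : t ≤ T) {D : Set Ω}
    (hD : MeasurableSet[hB.filtration s] D) {U : Set ℝ} (hU : MeasurableSet U) :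
    P.real (D ∩ {ω | B t ω - B s ω ∈ U}) = P.real D * P.real {ω | B t ω - B s ω ∈ U} := by
  have h := (Indep_iff _ _ P).1 (hB.indep_filtration hst ht) D {ω | B t ω - B s ω ∈ U} hD
    ⟨U, hU, rfl⟩
  rw [measureReal_def, h, ENNReal.toReal_mul]
  rfl

/-- Monotone integrable functions of the terminal value are integrable functions of translates of
the last increment. -/
lemma integrable_comp_add_increment {m : ℝ → ℝ} (hm : Monotone m) (hm0 : ∀ y, 0 ≤ m y)
    (hmi : Integrable (fun ω => m (B T ω)) P) {t : ℝ≥0} (h0 : 0 < t) (ht : t ≤ T) (x : ℝ) :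
    Integrable (fun ω => m (x + (B T ω - B t ω))) P := by
  have hmN : Measurable[MeasurableSpace.comap (fun ω => B T ω - B t ω) inferInstance]
      fun ω => ENNReal.ofReal (m (x + (B T ω - B t ω))) :=
    (ENNReal.measurable_ofReal.comp (hm.measurable.comp (measurable_const_add x))).comp
      (comap_measurable _)
  have hA : MeasurableSet[hB.filtration t] {ω | x ≤ B t ω} :=
    (hB.measurable_filtration le_rfl ht) measurableSet_Ici
  have hind := lintegral_mul_eq_lintegral_mul_lintegral_of_independent_measurableSpace
    (hB.filtration.le t) (hB.measurable_sub ht le_rfl).comap_le (hB.indep_filtration ht le_rfl)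
    ((measurable_const (a := (1 : ℝ≥0∞))).indicator hA) hmN
  -- Where `x ≤ B t`, the translate is dominated by `m (B T)`. By independence the left side is `P
  -- {x ≤ B t}` times the wanted integral. That probability is positive, so the integral is finite
  -- without any growth bound on `m`.
  have hle : ∫⁻ ω, {ω | x ≤ B t ω}.indicator (fun _ => (1 : ℝ≥0∞)) ω *
      ENNReal.ofReal (m (x + (B T ω - B t ω))) ∂P ≤ ∫⁻ ω, ENNReal.ofReal (m (B T ω)) ∂P := by
    refine lintegral_mono fun ω => ?_
    by_cases h : x ≤ B t ω
    · simp only [Set.indicator, Set.mem_ofPred_eq, h, if_true, one_mul]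
      exact ENNReal.ofReal_le_ofReal (hm (by linarith))
    · simp [Set.indicator, h]
  rw [hind, lintegral_indicator_const (hB.filtration.le t _ hA), one_mul] at hle
  have hfin : ∫⁻ ω, ENNReal.ofReal (m (B T ω)) ∂P < ∞ :=
    (hasFiniteIntegral_iff_ofReal (ae_of_all _ fun ω => hm0 _)).1 hmi.2
  have hpos : P {ω | x ≤ B t ω} ≠ 0 :=
    ((hB.measure_pos h0 ht isOpen_Ioi (Set.nonempty_Ioi (a := x))).trans_le
      (measure_mono fun ω h => by
          simp only [Set.mem_ofPred_eq, Set.mem_Ioi] at h ⊢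
          exact h.le)).ne'
  refine ⟨(hm.measurable.comp
    ((hB.measurable_sub ht le_rfl).const_add x)).aestronglyMeasurable, ?_⟩
  rw [hasFiniteIntegral_iff_ofReal (ae_of_all _ fun ω => hm0 _)]
  exact ENNReal.lt_top_of_mul_ne_top_right (hle.trans_lt hfin).ne hpos

/-- Where `B t ≤ x`, the terminal value is at most `x` plus the independent last increment. -/
lemma setIntegral_comp_le {m : ℝ → ℝ} (hm : Monotone m) (hm0 : ∀ y, 0 ≤ m y)
    (hmi : Integrable (fun ω => m (B T ω)) P) {t : ℝ≥0} (h0 : 0 < t) (ht : t ≤ T) {x : ℝ}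
    {C : Set Ω} (hC : MeasurableSet[hB.filtration t] C) (hCx : ∀ ω ∈ C, B t ω ≤ x) :
    ∫ ω in C, m (B T ω) ∂P ≤ P.real C * ∫ ω, m (x + (B T ω - B t ω)) ∂P := by
  have h := Indep.setIntegral_eq_mul (f := fun y => m (x + y)) (hB.filtration.le t)
    (hB.indep_filtration ht le_rfl) (hB.measurable_sub ht le_rfl).aemeasurable hC
    (hm.measurable.comp (measurable_const_add x)).aestronglyMeasurable
  rw [← h]
  refine setIntegral_mono_on hmi.integrableOn
    (hB.integrable_comp_add_increment hm hm0 hmi h0 ht x).integrableOn (hB.filtration.le t _ hC)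
    fun ω hω => hm ?_
  linarith [hCx ω hω]

variable [IsProbabilityMeasure P]

/-- By monotonicity the translate with `k = 0` dominates all the others. The limit describes
expectations at time `t` when `B t` is very low. -/
lemma tendsto_integral_comp_add_increment {m : ℝ → ℝ} (hm : Monotone m) (hm0 : ∀ y, 0 ≤ m y)
    (hmi : Integrable (fun ω => m (B T ω)) P) {t : ℝ≥0} (h0 : 0 < t) (ht : t ≤ T) {c : ℝ}
    (hc : Tendsto m atBot (𝓝 c)) (x : ℝ) :
    Tendsto (fun k : ℕ => ∫ ω, m ((x - k) + (B T ω - B t ω)) ∂P) atTop (𝓝 c) := by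
  have hlim : Tendsto (fun k : ℕ => ∫ ω, m ((x - k) + (B T ω - B t ω)) ∂P) atTop
      (𝓝 (∫ _, c ∂P)) := by
    refine tendsto_integral_of_dominated_convergence (fun ω => m (x + (B T ω - B t ω)))
      (fun k => (hB.integrable_comp_add_increment hm hm0 hmi h0 ht _).1)
      (hB.integrable_comp_add_increment hm hm0 hmi h0 ht x) (fun k => ae_of_all _ fun ω => ?_)
      (ae_of_all _ fun ω => ?_)
    · rw [Real.norm_of_nonneg (hm0 _)]
      exact hm (by linarith [k.cast_nonneg (α := ℝ)])
    · refine hc.comp ?_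
      have : Tendsto (fun k : ℕ => (x + (B T ω - B t ω)) + -(k : ℝ)) atTop atBot :=
        tendsto_atBot_add_const_left _ _ (tendsto_neg_atTop_atBot.comp tendsto_natCast_atTop_atTop)
      exact this.congr fun k => by ring
  simpa using hlim

end IsBrownianOn

/-! ## Portfolios that keep conditional expected wealth nonnegative -/

section Portfolio

variable [IsProbabilityMeasure P] (hB : IsBrownianOn P T B) {f g φ : ℝ → ℝ}
  {s t : ℝ≥0} {h₀ h₁ : Ω → ℝ}
include hB

/-- The bond holdings cannot fall below `-1`: the state may become so bad that the stock is
worthless and the endowment is close to `1`. -/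
lemma IsBrownianOn.neg_one_le_of_setIntegral_nonneg (hst : s < t) (ht : t ≤ T)
    (hfφ : ∀ y, f y ≤ φ y) (hφ : Monotone φ) (hφ0 : ∀ y, 0 ≤ φ y)
    (hφ_bot : Tendsto φ atBot (𝓝 1)) (hfi : Integrable (fun ω => f (B T ω)) P)
    (hφi : Integrable (fun ω => φ (B T ω)) P)
    (hg : Monotone g) (hg0 : ∀ y, 0 ≤ g y) (hg_bot : Tendsto g atBot (𝓝 0))
    (hgi : Integrable (fun ω => g (B T ω)) P)
    (hm₀ : StronglyMeasurable[hB.filtration s] h₀) (hm₁ : StronglyMeasurable[hB.filtration s] h₁)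
    (hi₀ : Integrable h₀ P) (hi₁ : Integrable (fun ω => h₁ ω * g (B T ω)) P)
    (hpos : ∀ C, MeasurableSet[hB.filtration t] C →
      0 ≤ ∫ ω in C, (h₀ ω + h₁ ω * g (B T ω) + f (B T ω)) ∂P) :
    ∀ᵐ ω ∂P, -1 ≤ h₀ ω := by
  have hsT := hst.le.trans ht
  have h0t : 0 < t := (zero_le).trans_lt hst
  -- The exceptional event is a countable union of events on which the violation is bounded below
  -- while the stock holding and `B s` are bounded above.
  suffices H : ∀ n : ℕ, ∀ᵐ ω ∂P,
      ¬ (h₀ ω ≤ -1 - 1 / ((n : ℝ) + 1) ∧ h₁ ω ≤ n ∧ B s ω ≤ n) by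
    filter_upwards [ae_all_iff.2 H] with ω hω
    by_contra! hlt
    have e1 : ∀ᶠ n : ℕ in atTop, 1 / ((n : ℝ) + 1) < -1 - h₀ ω :=
      tendsto_one_div_add_atTop_nhds_zero_nat.eventually_lt_const (by linarith)
    have e2 := tendsto_natCast_atTop_atTop.eventually_ge_atTop (h₁ ω)
    have e3 := tendsto_natCast_atTop_atTop.eventually_ge_atTop (B s ω)
    obtain ⟨n, h1, h2, h3⟩ := (e1.and (e2.and e3)).exists
    exact hω n ⟨by linarith, h2, h3⟩
  intro n
  set δ : ℝ := 1 / ((n : ℝ) + 1) with hδ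
  have hδ0 : 0 < δ := Nat.one_div_pos_of_nat
  set D : Set Ω := {ω | h₀ ω ≤ -1 - δ ∧ h₁ ω ≤ n ∧ B s ω ≤ n} with hD
  have hDm : MeasurableSet[hB.filtration s] D :=
    (hm₀.measurable measurableSet_Iic).inter ((hm₁.measurable measurableSet_Iic).inter
      (hB.measurable_filtration le_rfl hsT measurableSet_Iic))
  by_contra hcon
  have hDpos : 0 < P.real D := by
    rw [measureReal_def, ENNReal.toReal_pos_iff]
    refine ⟨pos_iff_ne_zero.2 fun h => hcon ?_, measure_lt_top _ _⟩
    rw [ae_iff]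
    simpa [hD] using h
  set m : ℝ → ℝ := fun y => n * g y + φ y with hm
  have hmm : Monotone m := fun x y hxy =>
    add_le_add (mul_le_mul_of_nonneg_left (hg hxy) n.cast_nonneg) (hφ hxy)
  have hm0 : ∀ y, 0 ≤ m y := fun y => add_nonneg (mul_nonneg n.cast_nonneg (hg0 y)) (hφ0 y)
  have hmi : Integrable (fun ω => m (B T ω)) P := (hgi.const_mul _).add hφi
  have hm_bot : Tendsto m atBot (𝓝 1) := by
    simpa using (hg_bot.const_mul (n : ℝ)).add hφ_bot
  have hlim := hB.tendsto_integral_comp_add_increment hmm hm0 hmi h0t ht hm_bot n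
  -- Starting from `D`, the path drops by at least `k` before time `t` with positive probability.
  -- There `B t ≤ n - k` and wealth is at most `-1 - δ + m (B T)`. As `k` grows the bound
  -- contradicts the limit `1`.
  have hge : ∀ k : ℕ, 1 + δ ≤ ∫ ω, m ((n - k) + (B T ω - B t ω)) ∂P := by
    intro k
    set C : Set Ω := D ∩ {ω | B t ω - B s ω ∈ Set.Iic (-(k : ℝ))} with hC
    have hCm : MeasurableSet[hB.filtration t] C := by
      refine (hB.filtration.mono hst.le _ hDm).inter ?_
      exact ((hB.measurable_filtration le_rfl ht).sub
        (hB.measurable_filtration hst.le ht)) measurableSet_Iic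
    have hCpos : 0 < P.real C := by
      rw [hC, hB.measure_inter_increment hst.le ht hDm measurableSet_Iic]
      refine mul_pos hDpos ?_
      rw [measureReal_def, ENNReal.toReal_pos_iff]
      exact ⟨(hB.measure_increment_pos hst ht isOpen_Iio (Set.nonempty_Iio (a := -(k : ℝ)))).trans_le
        (measure_mono fun ω h => by
          simp only [Set.mem_ofPred_eq, Set.mem_Iio, Set.mem_Iic] at h ⊢
          exact h.le), measure_lt_top _ _⟩
    have h1 := hpos C hCm
    have h2 : ∫ ω in C, (h₀ ω + h₁ ω * g (B T ω) + f (B T ω)) ∂P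
        ≤ ∫ ω in C, ((-1 - δ) + m (B T ω)) ∂P := by
      refine setIntegral_mono_on ((hi₀.add hi₁).add hfi).integrableOn
        ((integrable_const _).add hmi).integrableOn (hB.filtration.le t _ hCm) fun ω hω => ?_
      obtain ⟨⟨a1, a2, -⟩, -⟩ := hω
      have := mul_le_mul_of_nonneg_right a2 (hg0 (B T ω))
      have := hfφ (B T ω)
      simp only [hm]
      linarith
    have h3 : ∫ ω in C, ((-1 - δ) + m (B T ω)) ∂P
        = P.real C * (-1 - δ) + ∫ ω in C, m (B T ω) ∂P := by
      rw [integral_add (integrable_const _) hmi.integrableOn, setIntegral_const, smul_eq_mul]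
    have h4 := hB.setIntegral_comp_le hmm hm0 hmi h0t ht (x := n - k) hCm (by
      rintro ω ⟨⟨-, -, a3⟩, a4⟩
      simp only [Set.mem_ofPred_eq, Set.mem_Iic] at a4
      linarith)
    have h5 : 0 ≤ P.real C * (-1 - δ + ∫ ω, m ((n - k) + (B T ω - B t ω)) ∂P) := by linarith
    linarith [nonneg_of_mul_nonneg_right h5 hCpos]
  have := ge_of_tendsto' hlim hge
  linarith

/-- The stock cannot be held short: its value may grow beyond all bounds. -/
lemma IsBrownianOn.nonneg_of_setIntegral_nonneg (hst : s < t) (ht : t < T)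
    {M : ℝ} (hfM : ∀ y, f y ≤ M) (hfi : Integrable (fun ω => f (B T ω)) P)
    (hg : Monotone g) (hg0 : ∀ y, 0 ≤ g y) (hg_top : Tendsto g atTop atTop)
    (hgi : Integrable (fun ω => g (B T ω)) P)
    (hm₀ : StronglyMeasurable[hB.filtration s] h₀) (hm₁ : StronglyMeasurable[hB.filtration s] h₁)
    (hi₀ : Integrable h₀ P) (hi₁ : Integrable (fun ω => h₁ ω * g (B T ω)) P)
    (hpos : ∀ C, MeasurableSet[hB.filtration t] C →
      0 ≤ ∫ ω in C, (h₀ ω + h₁ ω * g (B T ω) + f (B T ω)) ∂P) :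
    ∀ᵐ ω ∂P, 0 ≤ h₁ ω := by
  have hsT := hst.le.trans ht.le
  suffices H : ∀ n : ℕ, ∀ᵐ ω ∂P,
      ¬ (h₀ ω ≤ n ∧ h₁ ω ≤ - (1 / ((n : ℝ) + 1)) ∧ -n ≤ B s ω) by
    filter_upwards [ae_all_iff.2 H] with ω hω
    by_contra! hlt
    have e1 : ∀ᶠ n : ℕ in atTop, 1 / ((n : ℝ) + 1) < - h₁ ω :=
      tendsto_one_div_add_atTop_nhds_zero_nat.eventually_lt_const (by linarith)
    have e2 := tendsto_natCast_atTop_atTop.eventually_ge_atTop (h₀ ω)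
    have e3 := tendsto_natCast_atTop_atTop.eventually_ge_atTop (-B s ω)
    obtain ⟨n, h1, h2, h3⟩ := (e1.and (e2.and e3)).exists
    exact hω n ⟨h2, by linarith, by linarith⟩
  intro n
  set δ : ℝ := 1 / ((n : ℝ) + 1) with hδ
  have hδ0 : 0 < δ := Nat.one_div_pos_of_nat
  set D : Set Ω := {ω | h₀ ω ≤ n ∧ h₁ ω ≤ -δ ∧ -n ≤ B s ω} with hD
  have hDm : MeasurableSet[hB.filtration s] D :=
    (hm₀.measurable measurableSet_Iic).inter ((hm₁.measurable measurableSet_Iic).inter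
      (hB.measurable_filtration le_rfl hsT measurableSet_Ici))
  by_contra hcon
  have hDpos : 0 < P.real D := by
    rw [measureReal_def, ENNReal.toReal_pos_iff]
    refine ⟨pos_iff_ne_zero.2 fun h => hcon ?_, measure_lt_top _ _⟩
    rw [ae_iff]
    simpa [hD] using h
  have hcpos : ∀ {r u : ℝ≥0}, r < u → u ≤ T → ∀ x : ℝ,
      0 < P.real {ω | B u ω - B r ω ∈ Set.Ici x} := by
    intro r u hru hu x
    rw [measureReal_def, ENNReal.toReal_pos_iff]
    exact ⟨(hB.measure_increment_pos hru hu isOpen_Ioi (Set.nonempty_Ioi (a := x))).trans_le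
      (measure_mono fun ω h => by
          simp only [Set.mem_ofPred_eq, Set.mem_Ioi, Set.mem_Ici] at h ⊢
          exact h.le), measure_lt_top _ _⟩
  set c : ℝ := P.real {ω | B T ω - B t ω ∈ Set.Ici (0 : ℝ)} with hc
  have hc0 : 0 < c := hcpos ht le_rfl 0
  -- After a rise of `k` from a level at least `-n`, the last increment is nonnegative with
  -- conditional probability `c`. The expected loss on the short position is then at least `δ * c *
  -- g (k - n)`, more than the bond and endowment can cover.
  obtain ⟨k, hk⟩ : ∃ k : ℕ, (n + M) / (δ * c) < g (k - n) := by
    have : Tendsto (fun k : ℕ => g ((k : ℝ) - n)) atTop atTop :=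
      hg_top.comp (tendsto_atTop_add_const_right _ _ tendsto_natCast_atTop_atTop)
    exact (this.eventually_gt_atTop _).exists
  rw [div_lt_iff₀ (mul_pos hδ0 hc0)] at hk
  set C : Set Ω := D ∩ {ω | B t ω - B s ω ∈ Set.Ici (k : ℝ)} with hC
  have hCm : MeasurableSet[hB.filtration t] C := by
    refine (hB.filtration.mono hst.le _ hDm).inter ?_
    exact ((hB.measurable_filtration le_rfl ht.le).sub
      (hB.measurable_filtration hst.le ht.le)) measurableSet_Ici
  have hCpos : 0 < P.real C := by
    rw [hC, hB.measure_inter_increment hst.le ht.le hDm measurableSet_Ici]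
    exact mul_pos hDpos (hcpos hst ht.le _)
  have hCm' := hB.filtration.le t _ hCm
  have h1 := hpos C hCm
  have h2 : ∫ ω in C, (h₀ ω + h₁ ω * g (B T ω) + f (B T ω)) ∂P
      ≤ ∫ ω in C, ((n + M) + -δ * g (B T ω)) ∂P := by
    refine setIntegral_mono_on ((hi₀.add hi₁).add hfi).integrableOn
      ((integrable_const _).add (hgi.const_mul _)).integrableOn hCm' fun ω hω => ?_
    obtain ⟨⟨a1, a2, -⟩, -⟩ := hω
    have := mul_le_mul_of_nonneg_right a2 (hg0 (B T ω))
    have := hfM (B T ω)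
    linarith
  have h3 : ∫ ω in C, ((n + M) + -δ * g (B T ω)) ∂P
      = P.real C * (n + M) - δ * ∫ ω in C, g (B T ω) ∂P := by
    rw [integral_add (integrable_const _) (hgi.const_mul _).integrableOn, setIntegral_const,
      smul_eq_mul, integral_const_mul]
    ring
  have h4 : g (k - n) * (P.real C * c) ≤ ∫ ω in C, g (B T ω) ∂P := by
    have hE : MeasurableSet {ω | B T ω - B t ω ∈ Set.Ici (0 : ℝ)} :=
      hB.measurable_sub ht.le le_rfl measurableSet_Ici
    rw [hc, ← hB.measure_inter_increment ht.le le_rfl hCm measurableSet_Ici]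
    calc g (k - n) * P.real (C ∩ {ω | B T ω - B t ω ∈ Set.Ici (0 : ℝ)})
        = ∫ ω in C ∩ {ω | B T ω - B t ω ∈ Set.Ici (0 : ℝ)}, g (k - n) ∂P := by
          rw [setIntegral_const, smul_eq_mul, mul_comm]
      _ ≤ ∫ ω in C ∩ {ω | B T ω - B t ω ∈ Set.Ici (0 : ℝ)}, g (B T ω) ∂P := by
          refine setIntegral_mono_on (integrable_const _).integrableOn hgi.integrableOn
            (hCm'.inter hE) ?_
          rintro ω ⟨⟨⟨-, -, a3⟩, a4⟩, a5⟩
          simp only [Set.mem_ofPred_eq, Set.mem_Ici] at a4 a5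
          exact hg (by linarith)
      _ ≤ ∫ ω in C, g (B T ω) ∂P :=
          setIntegral_mono_set hgi.integrableOn (ae_of_all _ fun ω => hg0 _)
            (Set.inter_subset_left.eventuallyLE)
  have h5 := mul_le_mul_of_nonneg_left h4 hδ0.le
  have h6 : 0 ≤ P.real C * (n + M - g (k - n) * (δ * c)) := by linarith
  linarith [nonneg_of_mul_nonneg_right h6 hCpos]

end Portfolio

end Brownian

/-! ## Almost simple self-financing strategies -/

section Strategies

variable {Ω ι : Type*} [mΩ : MeasurableSpace Ω] {P : Measure Ω} {𝓕 : Filtration ℝ≥0 mΩ} {T : ℝ≥0} {A : ι → Ω → ℝ}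
  {τ : ℕ → ℝ≥0} {θ : Strategy Ω ι}

/-- The strict inequality `τ i < t` matters: it leaves time for the path to move between the choice
of the portfolio and `t`. -/
lemma IsAlmostSimple.exists_mem_Ioc (hθ : IsAlmostSimple P 𝓕 T τ θ) {t : ℝ≥0} (h0 : 0 < t)
    (ht : t < T) : ∃ i, τ i < t ∧ t ≤ τ (i + 1) := by
  classical
  have hex : ∃ n, t ≤ τ n := (hθ.time_tendsto.eventually_const_le ht).exists
  have hn : Nat.find hex ≠ 0 := fun h => by
    have := Nat.find_spec hex
    rw [h, hθ.time_zero] at this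
    exact absurd this h0.not_ge
  obtain ⟨i, hi⟩ := Nat.exists_eq_succ_of_ne_zero hn
  exact ⟨i, not_le.1 (Nat.find_min hex (by omega)), by
    have := Nat.find_spec hex
    rwa [hi] at this⟩

variable [Fintype ι]

/-- The market value over one trading period, when portfolio changes are financed by gains. -/
lemma IsSelfFinancingGains.marketValue_left (hθ : IsAlmostSimple P 𝓕 T τ θ)
    (hs : IsSelfFinancingGains P 𝓕 T A τ θ) (n : ℕ) :
    marketValue P 𝓕 A θ (τ n) =ᵐ[P]
      fun ω => ∑ j, θ (τ (n + 1)) ω j * assetPrice P 𝓕 A j (τ n) ω := by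
  have hmono : τ n ≤ τ (n + 1) := hθ.time_mono n.le_succ
  -- The same `n + 1` gains are evaluated at both ends of the period. The first `n` coincide, and
  -- the last vanishes at `τ n`.
  filter_upwards [hs.1 (n + 1) (τ (n + 1)) le_rfl, hs.1 (n + 1) (τ n) hmono] with ω h1 h2
  rw [Finset.sum_range_succ] at h1 h2
  have e : ∀ i ∈ Finset.range n,
      ∑ j, θ (τ (i + 1)) ω j * (assetPrice P 𝓕 A j (min (τ (i + 1)) (τ (n + 1))) ω -
        assetPrice P 𝓕 A j (min (τ i) (τ (n + 1))) ω) =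
      ∑ j, θ (τ (i + 1)) ω j * (assetPrice P 𝓕 A j (min (τ (i + 1)) (τ n)) ω -
        assetPrice P 𝓕 A j (min (τ i) (τ n)) ω) := by
    intro i hi
    have hi := Finset.mem_range.1 hi
    rw [min_eq_left (hθ.time_mono (by omega : i + 1 ≤ n + 1)),
      min_eq_left (hθ.time_mono (by omega : i ≤ n + 1)),
      min_eq_left (hθ.time_mono (by omega : i + 1 ≤ n)),
      min_eq_left (hθ.time_mono (by omega : i ≤ n))]
  rw [Finset.sum_congr rfl e] at h1
  simp only [min_self, min_eq_left hmono, min_eq_right hmono, sub_self, mul_zero,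
    Finset.sum_const_zero, add_zero, mul_sub, Finset.sum_sub_distrib] at h1 h2
  have h3 : marketValue P 𝓕 A θ (τ (n + 1)) ω =
      ∑ j, θ (τ (n + 1)) ω j * assetPrice P 𝓕 A j (τ (n + 1)) ω := rfl
  linarith

variable [IsProbabilityMeasure P]

/-- The market value of an `𝓕 s`-measurable portfolio is its conditional expected dividend. -/
lemma condExp_sum_mul_eq {h : Ω → ι → ℝ} {s t : ℝ≥0} (hst : s ≤ t)
    (hm : ∀ j, StronglyMeasurable[𝓕 s] fun ω => h ω j) (hL : ∀ j, MemLp (fun ω => h ω j) 2 P)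
    (hA : ∀ j, MemLp (A j) 2 P) :
    P[fun ω => ∑ j, h ω j * A j ω | 𝓕 t] =ᵐ[P] fun ω => ∑ j, h ω j * assetPrice P 𝓕 A j t ω := by
  have e : (fun ω => ∑ j, h ω j * A j ω) = ∑ j, (fun ω => h ω j) * A j := by
    ext ω; simp
  rw [e]
  refine (condExp_finsetSum (fun j _ => (hL j).integrable_mul (hA j)) _).trans ?_
  have h1 : ∀ᵐ ω ∂P, ∀ j, P[(fun ω => h ω j) * A j | 𝓕 t] ω = h ω j * P[A j | 𝓕 t] ω :=
    ae_all_iff.2 fun j => condExp_mul_of_stronglyMeasurable_left ((hm j).mono (𝓕.mono hst))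
      ((hL j).integrable_mul (hA j)) ((hA j).integrable (by norm_num))
  filter_upwards [h1] with ω hω
  simp [hω, assetPrice]

/-- Before the terminal date, a self-financing almost simple strategy holds a portfolio fixed
strictly earlier whose dividend predicts the terminal net trade. -/
lemma IsAlmostSimple.exists_portfolio (hθ : IsAlmostSimple P 𝓕 T τ θ)
    (hs : IsSelfFinancing P 𝓕 T A θ ∨ IsSelfFinancingGains P 𝓕 T A τ θ)
    (hA : ∀ j, MemLp (A j) 2 P) (hAm : ∀ j, StronglyMeasurable[𝓕 T] (A j)) {z : Ω → ℝ}
    (hz : SupportsNetTrade P T A θ z) {t : ℝ≥0} (h0 : 0 < t) (ht : t < T) :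
    ∃ s < t, ∃ h : Ω → ι → ℝ, (∀ j, StronglyMeasurable[𝓕 s] (fun ω => h ω j) ∧
      MemLp (fun ω => h ω j) 2 P) ∧
      P[fun ω => ∑ j, h ω j * A j ω | 𝓕 t] =ᵐ[P] P[z | 𝓕 t] := by
  obtain ⟨i, hi, hti⟩ := hθ.exists_mem_Ioc h0 ht
  obtain ⟨h, hm, hθh⟩ := hθ.piecewise
  have hiT : τ i < T := hi.trans ht
  refine ⟨τ i, hi, h i, hm i hiT, ?_⟩
  rcases hs with hs | hs
  · have e : (fun ω => ∑ j, h i ω j * A j ω) = dividend A θ t := by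
      ext ω
      simp only [dividend, hθh i t hi hti]
    rw [e]
    exact (hs t T ht.le le_rfl).trans (condExp_congr_ae hz.2)
  set D : ℕ → Ω → ℝ := fun n ω => ∑ j, h n ω j * A j ω with hD
  have hright : ∀ n, τ n < T → marketValue P 𝓕 A θ (τ (n + 1)) =ᵐ[P] P[D n | 𝓕 (τ (n + 1))] := by
    intro n hn
    have hlt := hθ.time_lt n hn
    refine EventuallyEq.trans (Eq.eventuallyEq ?_)
      (condExp_sum_mul_eq hlt.le (fun j => (hm n hn j).1) (fun j => (hm n hn j).2) hA).symm
    ext ω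
    simp only [marketValue, hθh n _ hlt le_rfl]
  have hleft : ∀ n, τ n < T → marketValue P 𝓕 A θ (τ n) =ᵐ[P] P[D n | 𝓕 (τ n)] := by
    intro n hn
    have hlt := hθ.time_lt n hn
    refine (hs.marketValue_left hθ n).trans ?_
    rw [hθh n _ hlt le_rfl]
    exact (condExp_sum_mul_eq le_rfl (fun j => (hm n hn j).1) (fun j => (hm n hn j).2) hA).symm
  -- Market values at later trading times form a martingale: over each period both end values are
  -- conditional expectations of the same dividend `D n`. Once `τ n = T` the times are stationary.
  have hV : ∀ n, i + 1 ≤ n → Integrable (marketValue P 𝓕 A θ (τ n)) P ∧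
      P[marketValue P 𝓕 A θ (τ n) | 𝓕 t] =ᵐ[P] P[D i | 𝓕 t] := by
    intro n hn
    induction n, hn using Nat.le_induction with
    | base =>
      exact ⟨integrable_condExp.congr (hright i hiT).symm, (condExp_congr_ae (hright i hiT)).trans
        (condExp_condExp_of_le (𝓕.mono hti) (𝓕.le _))⟩
    | succ n hn ih =>
      rcases (hθ.time_le n).lt_or_eq with hnT | hnT
      · refine ⟨integrable_condExp.congr (hright n hnT).symm, EventuallyEq.trans ?_ ih.2⟩
        have htn : t ≤ τ n := hti.trans (hθ.time_mono hn)
        exact ((condExp_congr_ae (hright n hnT)).trans (condExp_condExp_of_le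
          (𝓕.mono (htn.trans (hθ.time_mono n.le_succ))) (𝓕.le _))).trans
          ((condExp_congr_ae (hleft n hnT)).trans
          (condExp_condExp_of_le (𝓕.mono htn) (𝓕.le _))).symm
      · have : τ (n + 1) = τ n :=
          le_antisymm ((hθ.time_le _).trans hnT.ge) (hθ.time_mono n.le_succ)
        rw [this]
        exact ih
  have hVT : marketValue P 𝓕 A θ T =ᵐ[P] z := by
    refine EventuallyEq.trans (Eq.eventuallyEq ?_) hz.2
    ext ω
    simp only [marketValue, dividend, assetPrice]
    refine Finset.sum_congr rfl fun j _ => ?_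
    rw [condExp_of_stronglyMeasurable (𝓕.le T) (hAm j) ((hA j).integrable (by norm_num))]
  have hVTi : Integrable (marketValue P 𝓕 A θ T) P :=
    (hz.1.integrable (by norm_num)).congr hVT.symm
  refine EventuallyEq.trans ?_ (condExp_congr_ae hVT)
  -- The left side does not depend on `n`. Conditional expectation contracts the `L¹` norm, so the
  -- assumed limit in mean forces it to be zero.
  have hle : ∀ᶠ n in atTop, eLpNorm (P[D i | 𝓕 t] - P[marketValue P 𝓕 A θ T | 𝓕 t]) 1 P ≤
      eLpNorm (fun ω => marketValue P 𝓕 A θ (τ n) ω - marketValue P 𝓕 A θ T ω) 1 P := by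
    filter_upwards [eventually_ge_atTop (i + 1)] with n hn
    obtain ⟨hn1, hn2⟩ := hV n hn
    refine le_trans (le_of_eq (eLpNorm_congr_ae ?_))
      (eLpNorm_condExp_le_eLpNorm (m := 𝓕 t) _ le_rfl)
    exact (hn2.symm.sub EventuallyEq.rfl).trans (condExp_sub hn1 hVTi _).symm
  have hzero := le_antisymm (ge_of_tendsto hs.2 hle) zero_le
  rw [eLpNorm_eq_zero_iff (integrable_condExp.sub integrable_condExp).1 one_ne_zero] at hzero
  filter_upwards [hzero] with ω hω
  simpa [sub_eq_zero] using hω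

end Strategies

/-! ## The wealth constraint keeps terminal wealth away from the equilibrium consumption -/

section Example

variable {Ω : Type*} [mΩ : MeasurableSpace Ω] {P : Measure Ω} {T : ℝ≥0} {B : ℝ≥0 → Ω → ℝ}
  {f g : ℝ → ℝ}

lemma StrictMono.pos_of_tendsto_atBot_zero (hg : StrictMono g) (hg_bot : Tendsto g atBot (𝓝 0))
    (y : ℝ) : 0 < g y :=
  (hg.monotone.le_of_tendsto hg_bot (y - 1)).trans_lt (hg (by linarith))

lemma IsBrownianOn.memLp_comp (hB : IsBrownianOn P T B) (hg : Continuous g)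
    (hg_sq : Integrable (fun x => g x ^ 2) (gaussianReal 0 T)) :
    MemLp (fun ω => g (B T ω)) 2 P := by
  have h1 : MemLp g 2 (gaussianReal 0 T) :=
    (memLp_two_iff_integrable_sq hg.aestronglyMeasurable).2 hg_sq
  have h2 := hB.gaussian 0 T zero_le le_rfl
  rw [tsub_zero] at h2
  rw [← h2] at h1
  refine (h1.comp_of_map (hB.measurable_sub zero_le le_rfl).aemeasurable).ae_eq ?_
  filter_upwards [hB.zero] with ω hω
  simp [hω]

variable [IsProbabilityMeasure P]

/-- Late enough, there is an event on which the endowment is expected to be close to its peak. -/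
lemma IsBrownianOn.exists_lt_setIntegral (hB : IsBrownianOn P T B) (hT : 0 < T)
    (hf : Continuous f) (hf0 : ∀ y, 0 ≤ f y) (hf_zero : 3 < f 0)
    (hfi : Integrable (fun ω => f (B T ω)) P) {b : ℝ} (hb : b < 3) :
    ∃ t, 0 < t ∧ t < T ∧ ∃ C, MeasurableSet[hB.filtration t] C ∧
      b * P.real C < ∫ ω in C, f (B T ω) ∂P := by
  obtain ⟨r, hr, hfr⟩ := Metric.eventually_nhds_iff.1 (hf.continuousAt.eventually_const_lt hf_zero)
  obtain ⟨u, -, hu, hulim⟩ := exists_seq_strictMono_tendsto' hT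
  have hconv : ∀ᵐ ω ∂P, Tendsto (fun n => B (u n) ω) atTop (𝓝 (B T ω)) := by
    filter_upwards [hB.continuousOn] with ω hω
    exact (hω T (Set.mem_Iic.2 le_rfl)).tendsto.comp
      (tendsto_nhdsWithin_iff.2 ⟨hulim, Eventually.of_forall fun n => (hu n).2.le⟩)
  have hmeas := tendstoInMeasure_of_tendsto_ae
    (fun n => (hB.measurable _ (hu n).2.le).aestronglyMeasurable) hconv
  -- Half of the radius `r` is for `B t`, half for the last increment. The bound `(3 - b) / 3` on
  -- the probability of a larger increment is what yields `b < 3 * P.real E`.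
  have hsmall := (hmeas (ENNReal.ofReal (r / 2)) (by simpa using hr)).eventually_lt_const
    (show 0 < ENNReal.ofReal ((3 - b) / 3) by simpa using hb)
  obtain ⟨n, hn⟩ := hsmall.exists
  obtain ⟨ht0, htT⟩ := hu n
  set t := u n with htdef
  set E : Set Ω := {ω | B T ω - B t ω ∈ Set.Ioo (-(r / 2)) (r / 2)} with hE
  have hEm : MeasurableSet E := hB.measurable_sub htT.le le_rfl measurableSet_Ioo
  have hEc : P.real Eᶜ < (3 - b) / 3 := by
    rw [measureReal_def]
    refine (ENNReal.toReal_lt_of_lt_ofReal (lt_of_le_of_lt (measure_mono fun ω hω => ?_) hn))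
    simp only [Set.mem_ofPred_eq]
    rw [edist_dist, ENNReal.ofReal_le_ofReal_iff dist_nonneg, dist_comm, Real.dist_eq]
    by_contra! hlt
    exact hω (abs_lt.1 hlt)
  have hEp : b < 3 * P.real E := by
    rw [probReal_compl_eq_one_sub hEm] at hEc
    linarith
  set C : Set Ω := {ω | B t ω ∈ Set.Ioo (-(r / 2)) (r / 2)} with hC
  have hCm : MeasurableSet[hB.filtration t] C :=
    hB.measurable_filtration le_rfl htT.le measurableSet_Ioo
  have hCpos : 0 < P.real C := by
    rw [measureReal_def, ENNReal.toReal_pos_iff]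
    exact ⟨hB.measure_pos ht0 htT.le isOpen_Ioo (Set.nonempty_Ioo.2 (by linarith)),
      measure_lt_top _ _⟩
  refine ⟨t, ht0, htT, C, hCm, ?_⟩
  have hCm' := hB.filtration.le t _ hCm
  calc b * P.real C < 3 * P.real E * P.real C := mul_lt_mul_of_pos_right hEp hCpos
    _ = ∫ ω in C ∩ E, (3 : ℝ) ∂P := by
      rw [setIntegral_const, hE, hB.measure_inter_increment htT.le le_rfl hCm measurableSet_Ioo,
        smul_eq_mul]
      ring
    _ ≤ ∫ ω in C ∩ E, f (B T ω) ∂P := by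
      refine setIntegral_mono_on (integrable_const _).integrableOn hfi.integrableOn
        (hCm'.inter hEm) ?_
      rintro ω ⟨⟨h1, h2⟩, ⟨h3, h4⟩⟩
      refine (hfr ?_).le
      rw [Real.dist_eq, sub_zero, abs_lt]
      constructor <;> linarith
    _ ≤ ∫ ω in C, f (B T ω) ∂P :=
      setIntegral_mono_set hfi.integrableOn (ae_of_all _ fun ω => hf0 _)
        (Set.inter_subset_left.eventuallyLE)

/-- A function that increases up to `0` and decreases afterwards lies below the monotone function
that agrees with it up to `0`. -/
lemma exists_monotone_majorant (hf : Continuous f) (hf_neg : ∀ c < 0, 0 < deriv f c)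
    (hf_pos : ∀ c > 0, deriv f c < 0) :
    Monotone (fun y => f (min y 0)) ∧ ∀ y, f y ≤ f (min y 0) := by
  have h1 : StrictMonoOn f (Set.Iic 0) :=
    strictMonoOn_of_deriv_pos (convex_Iic 0) hf.continuousOn fun x hx =>
      hf_neg x (by simpa using hx)
  have h2 : StrictAntiOn f (Set.Ici 0) :=
    strictAntiOn_of_deriv_neg (convex_Ici 0) hf.continuousOn fun x hx =>
      hf_pos x (by simpa using hx)
  refine ⟨fun x y hxy => h1.monotoneOn (Set.mem_Iic.2 (min_le_right x 0))
    (Set.mem_Iic.2 (min_le_right y 0)) (min_le_min_right 0 hxy), fun y => ?_⟩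
  rcases le_total y 0 with h | h
  · rw [min_eq_left h]
  · rw [min_eq_right h]
    exact h2.antitoneOn (Set.mem_Ici.2 le_rfl) (Set.mem_Ici.2 h) h

/-- The terminal wealth constraint forces bond holdings of at least `-1` and nonnegative stock
holdings, so expected wealth is at least the expected endowment less `1`. -/
lemma IsBrownianOn.sub_measure_le_setIntegral (hB : IsBrownianOn P T B)
    (hf : Continuous f) (hf_range : ∀ c, 1 < f c ∧ f c < 4)
    (hf_neg : ∀ c < 0, 0 < deriv f c) (hf_pos : ∀ c > 0, deriv f c < 0)
    (hf_bot : Tendsto f atBot (𝓝 1))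
    (hg_mono : StrictMono g) (hg_bot : Tendsto g atBot (𝓝 0)) (hg_top : Tendsto g atTop atTop)
    (hgL : MemLp (fun ω => g (B T ω)) 2 P) {s t : ℝ≥0} (hst : s < t) (ht : t < T)
    {h : Ω → Fin 2 → ℝ} (hm : ∀ j, StronglyMeasurable[hB.filtration s] fun ω => h ω j)
    (hL : ∀ j, MemLp (fun ω => h ω j) 2 P)
    (hpos : ∀ C, MeasurableSet[hB.filtration t] C →
      0 ≤ ∫ ω in C, (∑ j, h ω j * exampleAsset g (B T) j ω + f (B T ω)) ∂P)
    (C : Set Ω) :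
    ∫ ω in C, f (B T ω) ∂P - P.real C ≤
      ∫ ω in C, (∑ j, h ω j * exampleAsset g (B T) j ω + f (B T ω)) ∂P := by
  have hBT := hB.measurable T le_rfl
  have hfi : Integrable (fun ω => f (B T ω)) P :=
    (memLp_comp_endowment hf hf_range hBT).integrable (by norm_num)
  have hgi : Integrable (fun ω => g (B T ω)) P := hgL.integrable (by norm_num)
  have hg0 : ∀ y, 0 ≤ g y := fun y => (hg_mono.pos_of_tendsto_atBot_zero hg_bot y).le
  -- The low-state estimate needs a monotone function, which `f` is not. The majorant keeps the
  -- limit `1` at `-∞`.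
  obtain ⟨hφ, hfφ⟩ := exists_monotone_majorant hf hf_neg hf_pos
  have hφi : Integrable (fun ω => f (min (B T ω) 0)) P :=
    (memLp_comp_endowment (f := fun y => f (min y 0)) (by fun_prop) (fun c => hf_range _)
      hBT).integrable (by norm_num)
  have hφ_bot : Tendsto (fun y => f (min y 0)) atBot (𝓝 1) := by
    refine hf_bot.congr' ?_
    filter_upwards [eventually_le_atBot 0] with y hy
    rw [min_eq_left hy]
  simp only [exampleAsset, Fin.sum_univ_two, Matrix.cons_val_zero, Matrix.cons_val_one,
    Matrix.cons_val_fin_one, mul_one] at hpos ⊢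
  have hi₀ : Integrable (fun ω => h ω 0) P := (hL 0).integrable (by norm_num)
  have hi₁ : Integrable (fun ω => h ω 1 * g (B T ω)) P := (hL 1).integrable_mul hgL
  have k0 := hB.neg_one_le_of_setIntegral_nonneg hst ht.le hfφ hφ
    (fun y => by linarith [hf_range (min y 0)]) hφ_bot hfi hφi hg_mono.monotone hg0 hg_bot hgi
    (hm 0) (hm 1) hi₀ hi₁ hpos
  have k1 := hB.nonneg_of_setIntegral_nonneg hst ht (fun y => (hf_range y).2.le) hfi
    hg_mono.monotone hg0 hg_top hgi (hm 0) (hm 1) hi₀ hi₁ hpos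
  calc ∫ ω in C, f (B T ω) ∂P - P.real C = ∫ ω in C, (f (B T ω) - 1) ∂P := by
        rw [integral_sub hfi.integrableOn (integrable_const _), setIntegral_const, smul_eq_mul,
          mul_one]
    _ ≤ ∫ ω in C, (h ω 0 + h ω 1 * g (B T ω) + f (B T ω)) ∂P := by
        refine integral_mono_ae (hfi.sub (integrable_const _)).integrableOn
          ((hi₀.add hi₁).add hfi).integrableOn (ae_restrict_of_ae ?_)
        filter_upwards [k0, k1] with ω h0 h1
        have := mul_nonneg h1 (hg0 (B T ω))
        linarith

end Example

/-! ## The example -/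

lemma partitionPayoff_eq_sum {Ω ι : Type*} [Fintype ι] (A : ι → Ω → ℝ) {N : ℕ} (X : Fin N → Set Ω)
    (α : ι → Fin N → ℝ) (ω : Ω) : partitionPayoff A X α ω =
      ∑ j, (∑ l, α j l * (X l).indicator (fun _ => (1 : ℝ)) ω) * A j ω := by
  simp only [partitionPayoff, Finset.sum_mul]

section Necessity

variable {Ω : Type*} [mΩ : MeasurableSpace Ω] {P : Measure Ω} [IsProbabilityMeasure P]

/-- On a probability space, integration over an event is a functional of `L²` norm at most `1`. A
lower bound on it thus excludes norm approximation. -/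
lemma setIntegral_le_eLpNorm_two {Y : Ω → ℝ} (hY : AEStronglyMeasurable Y P) (C : Set Ω) :
    ENNReal.ofReal (∫ ω in C, Y ω ∂P) ≤ eLpNorm Y 2 P := by
  calc ENNReal.ofReal (∫ ω in C, Y ω ∂P) ≤ ‖∫ ω in C, Y ω ∂P‖ₑ := Real.ofReal_le_enorm _
    _ ≤ ∫⁻ ω in C, ‖Y ω‖ₑ ∂P := enorm_integral_le_lintegral_enorm _
    _ ≤ ∫⁻ ω, ‖Y ω‖ₑ ∂P := setLIntegral_le_lintegral _ _
    _ = eLpNorm Y 1 P := eLpNorm_one_eq_lintegral_enorm.symm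
    _ ≤ eLpNorm Y 2 P := eLpNorm_le_eLpNorm_of_exponent_le (by norm_num) hY

lemma setIntegral_nonneg_of_condExp_nonneg {m : MeasurableSpace Ω} (hm : m ≤ mΩ) {Y : Ω → ℝ}
    (hY : Integrable Y P) (hpos : ∀ᵐ ω ∂P, 0 ≤ (P[Y | m]) ω) {C : Set Ω}
    (hC : MeasurableSet[m] C) : 0 ≤ ∫ ω in C, Y ω ∂P := by
  rw [← setIntegral_condExp hm hY hC]
  exact integral_nonneg_of_ae (ae_restrict_of_ae hpos)

lemma setIntegral_eq_of_condExp_eq {m : MeasurableSpace Ω} (hm : m ≤ mΩ) {Y Z : Ω → ℝ}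
    (hY : Integrable Y P) (hZ : Integrable Z P) (h : P[Y | m] =ᵐ[P] P[Z | m]) {C : Set Ω}
    (hC : MeasurableSet[m] C) : ∫ ω in C, Y ω ∂P = ∫ ω in C, Z ω ∂P := by
  rw [← setIntegral_condExp hm hY hC, ← setIntegral_condExp hm hZ hC]
  exact integral_congr_ae (ae_restrict_of_ae h)

end Necessity

theorem mainTheorem4 {Ω : Type*} [mΩ : MeasurableSpace Ω] (P : Measure Ω)
    [IsProbabilityMeasure P] (T : ℝ≥0) (hT : 0 < T)
    (B : ℝ≥0 → Ω → ℝ) (hB : IsBrownianOn P T B)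
    (f : ℝ → ℝ) (hf_smooth : ContDiff ℝ (⊤ : ℕ∞) f) (hf_range : ∀ c, 1 < f c ∧ f c < 4)
    (hf_neg : ∀ c < 0, 0 < deriv f c) (hf_pos : ∀ c > 0, deriv f c < 0) (hf_zero : 3 < f 0)
    (hf_bot : Tendsto f atBot (𝓝 1)) (hf_top : Tendsto f atTop (𝓝 1))
    (hf_mean : ∫ ω, f (B T ω) ∂P < 2)
    (w : ℝ → ℝ) (hw_smooth : ContDiff ℝ (⊤ : ℕ∞) w) (hw_mono : StrictMono w)
    (hw_concave : StrictConcaveOn ℝ Set.univ w)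
    (g : ℝ → ℝ) (hg_smooth : ContDiff ℝ (⊤ : ℕ∞) g) (hg_mono : StrictMono g)
    (hg_convex : ConvexOn ℝ Set.univ g)
    (hg_bot : Tendsto g atBot (𝓝 0)) (hg_top : Tendsto g atTop atTop)
    (hg_sq : Integrable (fun x => g x ^ 2) (gaussianReal 0 T)) :
    ∃ a : ℝ, a < 2 ∧
      -- the economy has a Walrasian equilibrium
      (∃ p x, IsWalrasianEquilibrium P (fun _ => expectedUtility P w)
        (exampleEndowment f (B T)) p x) ∧
      -- the equilibrium consumptions are unique: `(a, a)` and `(4 - a, 4 - a)`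
      (∀ p x, IsWalrasianEquilibrium P (fun _ => expectedUtility P w)
        (exampleEndowment f (B T)) p x →
        ((x 0).1 = a ∧ ∀ᵐ ω ∂P, (x 0).2 ω = a) ∧
        ((x 1).1 = 4 - a ∧ ∀ᵐ ω ∂P, (x 1).2 ω = 4 - a)) ∧
      -- the necessary condition fails for the net trade `a - f(B(T))` of consumer 1
      (∃ ε > 0, ∃ t : ℝ≥0, 0 < t ∧ t < T ∧
        ¬ PartitionCondition P P (brownianFiltration P T B hB.measurable)
            (exampleAsset g (B T)) (fun ω => f (B T ω)) (fun ω => a - f (B T ω)) t ε) ∧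
      -- no net of self-financing almost simple strategies does the job
      ¬ ∃ (κ : Type*) (l : Filter κ) (_ : l.NeBot) (θ : κ → Strategy Ω (Fin 2))
          (z : κ → Ω → ℝ),
          (∀ k, ∃ τ, IsAlmostSimple P (brownianFiltration P T B hB.measurable) T τ (θ k) ∧
            (IsSelfFinancing P (brownianFiltration P T B hB.measurable) T
                (exampleAsset g (B T)) (θ k) ∨
              IsSelfFinancingGains P (brownianFiltration P T B hB.measurable) T
                (exampleAsset g (B T)) τ (θ k))) ∧
          (∀ k, RespectsTerminalWealth P T (exampleAsset g (B T)) (fun ω => f (B T ω)) (θ k)) ∧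
          (∀ k, SupportsNetTrade P T (exampleAsset g (B T)) (θ k) (z k)) ∧
          TendstoWeakly P l z (fun ω => a - f (B T ω)) := by
  have hf := hf_smooth.continuous
  have hg := hg_smooth.continuous
  have hw : Differentiable ℝ w := hw_smooth.differentiable (by simp)
  have hBT := hB.measurable T le_rfl
  set a : ℝ := (1 + ∫ ω, f (B T ω) ∂P) / 2 with ha_def
  have ha : 2 * a = 1 + ∫ ω, f (B T ω) ∂P := by rw [ha_def]; ring
  have ha2 : a < 2 := by linarith
  have hfL : MemLp (fun ω => f (B T ω)) 2 P := memLp_comp_endowment hf hf_range hBT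
  have hfi : Integrable (fun ω => f (B T ω)) P := hfL.integrable (by norm_num)
  have hgL : MemLp (fun ω => g (B T ω)) 2 P := hB.memLp_comp hg hg_sq
  have hAL : ∀ j, MemLp (exampleAsset g (B T) j) 2 P := by
    intro j
    fin_cases j
    · exact memLp_const _
    · exact hgL
  have hAm : ∀ j, StronglyMeasurable[hB.filtration T] (exampleAsset g (B T) j) := by
    intro j
    fin_cases j
    · exact stronglyMeasurable_const
    · exact (hg.measurable.comp (hB.measurable_filtration le_rfl le_rfl)).stronglyMeasurable
  have hsum : ∀ {h : Ω → Fin 2 → ℝ}, (∀ j, MemLp (fun ω => h ω j) 2 P) →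
      Integrable (fun ω => ∑ j, h ω j * exampleAsset g (B T) j ω) P := fun hL =>
    integrable_finsetSum _ fun j _ => (hL j).integrable_mul (hAL j)
  obtain ⟨t, ht0, htT, C, hC, hgap⟩ := hB.exists_lt_setIntegral hT hf
    (fun y => by linarith [hf_range y]) hf_zero hfi (show 1 + a < 3 by linarith)
  -- The minimal wealth `f(B(T)) - 1`, less the target `a`, integrates over `C` to exactly `ε`.
  set ε : ℝ := ∫ ω in C, f (B T ω) ∂P - (1 + a) * P.real C with hε
  have hε0 : 0 < ε := sub_pos.2 hgap
  have hle := hB.filtration.le t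
  have key : ∀ {s : ℝ≥0}, s < t → ∀ {h : Ω → Fin 2 → ℝ},
      (∀ j, StronglyMeasurable[hB.filtration s] fun ω => h ω j) →
      (∀ j, MemLp (fun ω => h ω j) 2 P) →
      (∀ C, MeasurableSet[hB.filtration t] C →
        0 ≤ ∫ ω in C, (∑ j, h ω j * exampleAsset g (B T) j ω + f (B T ω)) ∂P) →
      ε ≤ ∫ ω in C, (∑ j, h ω j * exampleAsset g (B T) j ω - (a - f (B T ω))) ∂P := by
    intro s hst h hm hL hpos
    have h1 := hB.sub_measure_le_setIntegral hf hf_range hf_neg hf_pos hf_bot hg_mono hg_bot hg_top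
      hgL hst htT hm hL hpos C
    have h2 : ∫ ω in C, (∑ j, h ω j * exampleAsset g (B T) j ω - (a - f (B T ω))) ∂P =
        ∫ ω in C, (∑ j, h ω j * exampleAsset g (B T) j ω + f (B T ω)) ∂P - P.real C * a := by
      have hi : Integrable (fun ω => ∑ j, h ω j * exampleAsset g (B T) j ω + f (B T ω)) P :=
        (hsum hL).add hfi
      rw [← smul_eq_mul, ← setIntegral_const,
        ← integral_sub hi.integrableOn (integrable_const _)]
      exact integral_congr_ae (ae_of_all _ fun ω => by ring)
    rw [h2, hε]
    linarith
  refine ⟨a, ha2, ⟨_, _, isWalrasianEquilibrium_const hw hw_mono hw_concave hf hf_range hBT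
    hf_mean ha⟩, fun p x hx => hx.consumption_eq hw hw_mono hw_concave hf hf_range hBT ha,
    ⟨ε, hε0, t, ht0, htT, ?_⟩, ?_⟩
  · rintro ⟨s, -, hst, N, X, α, hX, -, -, hpos, hnorm⟩
    set h : Ω → Fin 2 → ℝ := fun ω j => ∑ l, α j l * (X l).indicator (fun _ => (1 : ℝ)) ω with hh
    have hm : ∀ j, StronglyMeasurable[hB.filtration s] fun ω => h ω j := fun j =>
      Finset.stronglyMeasurable_fun_sum _ fun l _ =>
        (stronglyMeasurable_const.indicator (hX l)).const_mul _
    have hL : ∀ j, MemLp (fun ω => h ω j) 2 P := fun j =>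
      memLp_finsetSum _ fun l _ =>
        ((memLp_const (1 : ℝ)).indicator (hB.filtration.le s _ (hX l))).const_mul _
    simp only [partitionPayoff_eq_sum] at hpos hnorm
    have hzi : Integrable
        (fun ω => ∑ j, h ω j * exampleAsset g (B T) j ω - (a - f (B T ω))) P :=
      (hsum hL).sub ((integrable_const a).sub hfi)
    have h1 := key hst hm hL fun C' hC' =>
      setIntegral_nonneg_of_condExp_nonneg hle ((hsum hL).add hfi) hpos hC'
    rw [← setIntegral_condExp hle hzi hC] at h1
    exact absurd ((ENNReal.ofReal_le_ofReal h1).trans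
      (setIntegral_le_eLpNorm_two integrable_condExp.1 C)) hnorm.not_ge
  · rintro ⟨κ, l, _, θ, z, hθ, hwealth, hz, hlim⟩
    -- The indicator of `C` serves as test function: weak convergence would send these integrals to
    -- `0`.
    have hge : ∀ k, ε ≤ ∫ ω, (z k ω - (a - f (B T ω))) * C.indicator (fun _ => (1 : ℝ)) ω ∂P := by
      intro k
      obtain ⟨τ, hτ, hself⟩ := hθ k
      obtain ⟨s, hst, h, hh, heq⟩ := hτ.exists_portfolio hself hAL hAm (hz k) ht0 htT
      have hL := fun j => (hh j).2
      have hzi : Integrable (z k) P := (hz k).1.integrable (by norm_num)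
      have hI := fun C' (hC' : MeasurableSet[hB.filtration t] C') =>
        setIntegral_eq_of_condExp_eq hle (hsum hL) hzi heq hC'
      -- The portfolio's dividend and `z k` have equal integrals over events of time `t`, so the
      -- terminal constraint on `z k` passes to the portfolio.
      have h1 := key hst (fun j => (hh j).1) hL fun C' hC' => by
        rw [integral_add (hsum hL).integrableOn hfi.integrableOn, hI C' hC',
          ← integral_add hzi.integrableOn hfi.integrableOn]
        refine integral_nonneg_of_ae (ae_restrict_of_ae ?_)
        filter_upwards [hwealth k, (hz k).2] with ω h1 h2
        rwa [h2] at h1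
      have hafi : Integrable (fun ω => a - f (B T ω)) P := (integrable_const a).sub hfi
      rw [integral_sub (hsum hL).integrableOn hafi.integrableOn, hI C hC,
        ← integral_sub hzi.integrableOn hafi.integrableOn, ← integral_indicator (hle C hC)] at h1
      refine h1.trans_eq (integral_congr_ae (ae_of_all _ fun ω => ?_))
      by_cases hω : ω ∈ C <;> simp [hω]
    have := ge_of_tendsto' (hlim _ ((memLp_const (1 : ℝ)).indicator (hle C hC))) hge
    linarith
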